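/- Let $(X,d)$ be a compact metric space, $Q\in(1,\infty)$, and let $\mu=\mathcal H^{\beta}$ be the $\beta$-dimensional Hausdorff measure for some $\beta>0$. We write $B(x,r)$ for open $d$-balls and $f_B$ for the $\mu$-average of $f$ over $B$. Assume: (A) $(X,d)$ is $\beta$-Ahlfors regular ($C^{-1}r^\beta\le \mathcal H^\beta(B(x,r))\le Cr^\beta$ for all $x\in X$, $0<r\le 2\operatorname{diam}X$) and of bounded turning (there is $K\ge1$ such that any $x,y\in X$ lie on a curve $\gamma$ with $\operatorname{diam}\gamma\le K\,d(x,y)$). (B) $(X,d,\mu,\mathcal E,\mathcal F,\Gamma)$ is a $Q$-Dirichlet space: $\mu$ is a Radon measure; $\mathcal F$ is a linear subspace of $L^Q(X,\mu)$; $\mathcal E:\mathcal F\to[0,\infty)$ is such that $\|f\|_{\mathcal F}=(\|f\|_{L^Q(\mu)}^Q+\mathcal E(f))^{1/Q}$ is a complete norm on $\mathcal F$; and to each $f\in\mathcal F$ is assigned a finite Borel measure $\Gamma\langle f\rangle$ with $\Gamma\langle f\rangle(X)=\mathcal E(f)$ such that - $\Gamma\langle\lambda f\rangle=|\lambda|^Q\,\Gamma\langle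 f\rangle$ for all $\lambda\in\mathbb R$; - $\Gamma\langle f+g\rangle(A)^{1/Q}\le\Gamma\langle f\rangle(A)^{1/Q}+\Gamma\langle g\rangle(A)^{1/Q}$ for all $f,g\in\mathcal F$ and Borel sets $A$; - if $f\in\mathcal F$ and $\varphi:\mathbb R\to\mathbb R$ is $1$-Lipschitz with $\varphi(0)=0$, then $\varphi\circ f\in\mathcal F$ and $\Gamma\langle\varphi\circ f\rangle\le\Gamma\langle f\rangle$; - (strong locality) if $f\in\mathcal F$, $A$ is open, and $f=c$ $\mu$-a.e. on $A$ for some $c\in\mathbb R$, then $\Gamma\langle f\rangle(A)=0$; - if $f_i\in\mathcal F$, $f_i\to f$ in $L^Q(X,\mu)$ and $\sup_i\mathcal E(f_i)<\infty$, then $f\in\mathcal F$ and $\Gamma\langle f\rangle(A)\le\liminf_i\Gamma\langle f_i\rangle(A)$ for every Borel set $A$. (C) $\mu$ is doubling on $(X,d)$, and there are constants $C,\sigma\ge1$ such that for every ball $B(x,r)$, $r>0$: $$\int_{B(x,r)}|f-f_{B(x,r)}|^Q\,d\mu\le C\,r^\beta\,\Gamma\langle f\rangle(B(x,\sigma r))\qquad\text{for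 all } f\in\mathcal F,$$ and there is $\varphi\in\mathcal F\cap C(X)$ with $\varphi=1$ on $B(x,r)$, $\varphi=0$ on $X\setminus B(x,2r)$ and $\mathcal E(\varphi)\le C\mu(B(x,r))/r^\beta$. Let $\rho$ be a metric on $X$ that is quasisymmetric to $d$ (there is a homeomorphism $\eta$ of $[0,\infty)$ with $\rho(x,y)/\rho(x,z)\le\eta(d(x,y)/d(x,z))$ whenever $x\ne z$), let $\nu$ be a doubling measure on $(X,\rho)$, and, with $B_\rho(x,r)$ the open $\rho$-balls, define for $f\in L^Q(X,\nu)$ $$\Xi(f)=\sup_{r>0}\int_X\frac1{\nu(B_\rho(x,r))}\int_{B_\rho(x,r)}\frac{|f(x)-f(y)|^Q}{\nu(B_\rho(x,r))}\,d\nu(y)\,d\nu(x)\in[0,\infty].$$ Let $\mathcal W=\{f\in L^Q(X,\nu):\Xi(f)<\infty\}$ and $\|f\|_{\mathcal W}=\|f\|_{L^Q(X,\nu)}+\Xi(f)^{1/Q}$. Then $\mathcal F\cap C(X)=\mathcal W\cap C(X)$, and there is a constant $C\ge1$ such that for all $f\in\mathcal F\cap C(X)$ $$C^{-1}\|f\|_{\mathcal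 W}\le\|f\|_{\mathcal F}\le C\|f\|_{\mathcal W}.$$ Here a doubling measure is a Radon measure $m$ for which there is $D\ge1$ such that every $x\in X$ and every $r>0$ satisfy $0<m(B(x,2r))\le D\,m(B(x,r))<\infty$ for balls of the metric in question, and a continuous function belongs to $\mathcal F$ (or $\mathcal W$) if its class in $L^Q(X,\mu)$ (or $L^Q(X,\nu)$) does. -/

import Mathlib

open MeasureTheory Filter Topology Set
open scoped NNReal ENNReal

noncomputable section

namespace ConfInv

/-! ### Metric spaces and measures -/

/-- `d` is quasisymmetric to `ρ`: there is a homeomorphism `η : [0,∞) → [0,∞)` with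
`d(x,y)/d(x,z) ≤ η(ρ(x,y)/ρ(x,z))` whenever `x ≠ z`.
(It follows that `d` and `ρ` induce the same topology.) -/
def Quasisymmetric {X : Type*} (d ρ : MetricSpace X) : Prop :=
  ∃ η : ℝ≥0 ≃ₜ ℝ≥0, ∀ x y z : X, x ≠ z →
    d.toPseudoMetricSpace.toNNDist.nndist x y / d.toPseudoMetricSpace.toNNDist.nndist x z ≤
      η (ρ.toPseudoMetricSpace.toNNDist.nndist x y / ρ.toPseudoMetricSpace.toNNDist.nndist x z)

/-- `μ` is a doubling measure for the metric `d`. -/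
def IsDoubling {X : Type*} (d : MetricSpace X) [MeasurableSpace X] (μ : Measure X) : Prop :=
  ∃ D : ℝ, 1 ≤ D ∧ ∀ (x : X) (r : ℝ), 0 < r →
    0 < μ (Metric.ball x (2 * r)) ∧
    μ (Metric.ball x (2 * r)) ≤ ENNReal.ofReal D * μ (Metric.ball x r) ∧
    μ (Metric.ball x r) < ∞

/-- `Q`-Ahlfors regularity; `μH[Q]` is the `Q`-dimensional Hausdorff measure
(built from `diam(A)^Q` without further normalisation). -/
def AhlforsRegular (X : Type*) [MetricSpace X] [MeasurableSpace X] [BorelSpace X] (Q : ℝ) : Prop :=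
  ∃ C : ℝ, 1 ≤ C ∧ ∀ (x : X) (r : ℝ), 0 < r →
    ENNReal.ofReal r ≤ 2 * Metric.ediam (univ : Set X) →
    ENNReal.ofReal (C⁻¹ * r ^ Q) ≤ Measure.hausdorffMeasure Q (Metric.ball x r) ∧
    Measure.hausdorffMeasure Q (Metric.ball x r) ≤ ENNReal.ofReal (C * r ^ Q)

/-- Bounded turning: any two points lie on a curve of diameter at most `K` times their distance. -/
def BoundedTurning (X : Type*) [MetricSpace X] : Prop :=
  ∃ K : ℝ, 1 ≤ K ∧ ∀ x y : X, ∃ γ : C(unitInterval, X),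
    x ∈ range γ ∧ y ∈ range γ ∧ Metric.diam (range γ) ≤ K * dist x y

/-! ### Dirichlet spaces -/

/-- The Sobolev norm `(‖f‖_{L^p}^p + E(f))^{1/p}`. -/
def sobolevNorm {X : Type*} [MeasurableSpace X] {p : ℝ} {μ : Measure X}
    {F : Submodule ℝ (Lp ℝ (ENNReal.ofReal p) μ)} (E : F → ℝ≥0) (f : F) : ℝ :=
  (‖(f : Lp ℝ (ENNReal.ofReal p) μ)‖ ^ p + (E f : ℝ)) ^ (1 / p)

/-- A `p`-Dirichlet space `(X, d, μ, E, F, Γ)`. -/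
structure DirichletSpace {X : Type*} [MetricSpace X] [MeasurableSpace X] [BorelSpace X]
    (p : ℝ) (μ : Measure X) where
  one_lt : 1 < p
  complete : CompleteSpace X
  locallyCompact : LocallyCompactSpace X
  radon : μ.Regular
  /-- the space `F ⊆ L^p(X, μ)` -/
  F : Submodule ℝ (Lp ℝ (ENNReal.ofReal p) μ)
  /-- the energy `E : F → [0,∞)` -/
  E : F → ℝ≥0
  /-- the energy measures -/
  Γ : F → Measure X
  /-- `F` with its Sobolev norm is a Banach space
  (definiteness is inherited from the `L^p`-norm) -/
  norm_add_le : ∀ f g : F, sobolevNorm E (f + g) ≤ sobolevNorm E f + sobolevNorm E g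
  norm_smul : ∀ (c : ℝ) (f : F), sobolevNorm E (c • f) = |c| * sobolevNorm E f
  norm_complete : ∀ u : ℕ → F,
    (∀ ε : ℝ, 0 < ε → ∃ N : ℕ, ∀ m n : ℕ, N ≤ m → N ≤ n → sobolevNorm E (u m - u n) < ε) →
    ∃ f : F, Tendsto (fun n => sobolevNorm E (u n - f)) atTop (𝓝 0)
  /-- total mass and homogeneity -/
  mass : ∀ f : F, Γ f univ = (E f : ℝ≥0∞)
  homogeneous : ∀ (c : ℝ) (f : F), Γ (c • f) = ENNReal.ofReal (|c| ^ p) • Γ f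
  /-- triangle inequality -/
  triangle : ∀ (f g : F) (A : Set X), MeasurableSet A →
    Γ (f + g) A ^ (1 / p) ≤ Γ f A ^ (1 / p) + Γ g A ^ (1 / p)
  /-- Lipschitz contractivity -/
  contraction : ∀ (f : F) (φ : ℝ → ℝ) (hφ : LipschitzWith 1 φ) (h0 : φ 0 = 0),
    ∃ h : hφ.compLp h0 (f : Lp ℝ (ENNReal.ofReal p) μ) ∈ F, Γ ⟨_, h⟩ ≤ Γ f
  /-- strong locality: `Γ⟨f⟩` does not charge an open set on which `f` is constant -/
  local_ : ∀ (f : F) (A : Set X) (c : ℝ), IsOpen A →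
    (∀ᵐ x ∂μ, x ∈ A → (f : Lp ℝ (ENNReal.ofReal p) μ) x = c) → Γ f A = 0
  /-- weak lower semicontinuity -/
  lsc : ∀ (f : Lp ℝ (ENNReal.ofReal p) μ) (u : ℕ → F),
    Tendsto (fun i => ‖(u i : Lp ℝ (ENNReal.ofReal p) μ) - f‖) atTop (𝓝 0) →
    BddAbove (range fun i => E (u i)) →
    ∃ h : f ∈ F, ∀ A : Set X, MeasurableSet A →
      Γ ⟨f, h⟩ A ≤ liminf (fun i => Γ (u i) A) atTop

/-- `(p, β)`-Poincaré–Dirichlet space: volume doubling, the Poincaré inequality and the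
upper capacity bound, all with the scale function `r ↦ r ^ β`. -/
structure IsPoincareDirichlet {X : Type*} [d : MetricSpace X] [MeasurableSpace X] [BorelSpace X]
    {p : ℝ} {μ : Measure X} (D : DirichletSpace p μ) (β : ℝ) : Prop where
  doubling : IsDoubling d μ
  poincare : ∃ C σ : ℝ, 1 ≤ C ∧ 1 ≤ σ ∧ ∀ (x : X) (r : ℝ), 0 < r → ∀ f : D.F,
    ∫⁻ y in Metric.ball x r,
        ENNReal.ofReal (|(f : Lp ℝ (ENNReal.ofReal p) μ) y -
          ⨍ z in Metric.ball x r, (f : Lp ℝ (ENNReal.ofReal p) μ) z ∂μ| ^ p) ∂μ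
      ≤ ENNReal.ofReal (C * r ^ β) * D.Γ f (Metric.ball x (σ * r))
  capacity : ∃ C : ℝ, 1 ≤ C ∧ ∀ (x : X) (r : ℝ), 0 < r → ∃ (φ : C(X, ℝ)) (u : D.F),
    φ =ᵐ[μ] (u : Lp ℝ (ENNReal.ofReal p) μ) ∧
    (∀ y ∈ Metric.ball x r, φ y = 1) ∧
    (∀ y ∉ Metric.ball x (2 * r), φ y = 0) ∧
    (D.E u : ℝ≥0∞) ≤ ENNReal.ofReal C * (μ (Metric.ball x r) / ENNReal.ofReal (r ^ β))

/-- The standing assumption on `(X, d, μ, E, F, Γ)` with parameters `p`, `β`, `dH`. -/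
structure StandingAssumption {X : Type*} [MetricSpace X] [MeasurableSpace X] [BorelSpace X]
    {p : ℝ} {μ : Measure X} (D : DirichletSpace p μ) (β dH : ℝ) : Prop where
  beta_pos : 0 < β
  dH_pos : 0 < dH
  poincareDirichlet : IsPoincareDirichlet D β
  ahlfors : AhlforsRegular X dH
  measure_eq : μ = Measure.hausdorffMeasure dH
  boundedTurning : BoundedTurning X
  compact : CompactSpace X

/-! ### Auxiliary Sobolev spaces -/

/-- The data of an auxiliary Sobolev space: a metric `ρ` quasisymmetric to `d` and a doubling
measure `ν` on `(X, ρ)`. The energy and the function space are determined by these, see below. -/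
structure AuxSobolev (X : Type*) [d : MetricSpace X] [MeasurableSpace X] where
  ρ : MetricSpace X
  ν : Measure X
  quasisymmetric : Quasisymmetric ρ d
  doubling : IsDoubling ρ ν

namespace AuxSobolev

variable {X : Type*} [d : MetricSpace X] [MeasurableSpace X]

/-- The open ball of the metric `ρ`. -/
def ball (S : AuxSobolev X) (x : X) (r : ℝ) : Set X :=
  @Metric.ball X S.ρ.toPseudoMetricSpace x r

/-- The Korevaar–Schoen type `Q`-energy `Ξ : L^Q(X, ν) → [0,∞]`. -/
def Ξ (S : AuxSobolev X) (Q : ℝ) (f : Lp ℝ (ENNReal.ofReal Q) S.ν) : ℝ≥0∞ :=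
  ⨆ (r : ℝ) (_ : 0 < r),
    ∫⁻ x, (⨍⁻ y in S.ball x r,
      ENNReal.ofReal (|f x - f y| ^ Q) / S.ν (S.ball x r) ∂S.ν) ∂S.ν

/-- `W = L^Q(X, ν) ∩ Ξ⁻¹([0,∞))`. -/
def W (S : AuxSobolev X) (Q : ℝ) : Set (Lp ℝ (ENNReal.ofReal Q) S.ν) :=
  {f | S.Ξ Q f < ∞}

/-- The norm `‖f‖_{L^Q(X, ν)} + Ξ(f)^{1/Q}` of `W`. -/
def normW (S : AuxSobolev X) (Q : ℝ) (f : Lp ℝ (ENNReal.ofReal Q) S.ν) : ℝ :=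
  ‖f‖ + (S.Ξ Q f).toReal ^ (1 / Q)

end AuxSobolev

/-- The continuous functions whose a.e.-class belongs to a given set `V` of `L^q(X, μ)`, that is,
`V ∩ C(X)`. -/
def contIn {X : Type*} [TopologicalSpace X] [MeasurableSpace X] {q : ℝ≥0∞} {μ : Measure X}
    (V : Set (Lp ℝ q μ)) : Set C(X, ℝ) :=
  {f | ∃ u ∈ V, f =ᵐ[μ] u}

end ConfInv

end

noncomputable section

namespace ConfInv

/-! ### Geometry of doubling measures -/

section Doubling

variable {X : Type*} [d : MetricSpace X] [MeasurableSpace X] {ν : Measure X}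

/-! The Hausdorff dimension equals the scaling exponent `β`, so Ahlfors regularity makes `r ^ β`
comparable to `μ (B(x, r))`. The Poincaré inequality becomes `∫_B |f - c|^Q dμ ≤ C μ(B) Γ(ΛB)`, and
the cutoff functions have energy bounded by a constant. No power of the radius remains. By
`DistortionControl.exists_radius` every `ρ`-ball is comparable to a `d`-ball, so both properties and
the doubling of `μ` pass to `ρ`. The rest of the argument uses `ρ` only.

Energy bounds `Ξ` (`IsDoubling.exists_ksEnergy_le`): for continuous `f`, the difference between `f
x` and its `μ`-average over `B(x, s)` telescopes over the balls of radius `s / 4 ^ i`. The Poincaré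
inequality bounds the `p`-th power of each increment by `Γ (B(x, Λ s / 4 ^ i))`. After integration
against `dν(x) / ν(B(x, s))`, Fubini turns this into an integral over `Γ` of quotients of
`ν`-measures of concentric balls. These decay geometrically by reverse doubling, which holds because
bounded turning makes `X` connected. The measures `μ` and `ν` need not be related, since continuity
gives convergence of the averages at every point.

`Ξ` bounds energy (`HasCutoffs.exists_energy_le`): `f` is replaced by a discrete convolution at
scale `r`, whose coefficients are `ν`-averages over the balls of a net. Only contraction and the
triangle inequality are available, with no product rule, so the partition of unity is built by
lattice operations. Locality bounds the energy on each ball by finitely many differences of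
averages, hence by a local part of the Korevaar–Schoen integral. As `r → 0` the convolutions
converge uniformly to `f`, and lower semicontinuity concludes.

Lebesgue norms (`exists_eLpNorm_le`): the telescoping argument at the scale of the whole space
bounds the oscillation of `f` about its mean in both `L^Q(μ)` and `L^Q(ν)` by the energy. The two
norms therefore agree up to constants and an energy term. -/

theorem IsDoubling.measure_ball_pos (hν : IsDoubling d ν) (x : X) {r : ℝ} (hr : 0 < r) :
    0 < ν (Metric.ball x r) := by
  obtain ⟨D, -, h⟩ := hν
  simpa [mul_div_cancel₀] using (h x (r / 2) (by positivity)).1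

theorem IsDoubling.measure_ball_lt_top (hν : IsDoubling d ν) (x : X) {r : ℝ} (hr : 0 < r) :
    ν (Metric.ball x r) < ∞ := by
  obtain ⟨D, -, h⟩ := hν
  exact (h x r hr).2.2

/-- Comparison of the measures of balls with comparable radii and nearby centres. -/
theorem IsDoubling.exists_measure_ball_le (hν : IsDoubling d ν) (Λ : ℝ) :
    ∃ K : ℝ≥0, 1 ≤ K ∧ ∀ (x y : X) (r s : ℝ), 0 < r → s ≤ Λ * r → dist x y ≤ Λ * r →
      ν (Metric.ball x s) ≤ K * ν (Metric.ball y r) := by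
  obtain ⟨D, hD1, hD⟩ := hν
  have hpow : ∀ (n : ℕ) (y : X) (r : ℝ), 0 < r →
      ν (Metric.ball y (2 ^ n * r)) ≤ ENNReal.ofReal D ^ n * ν (Metric.ball y r) := by
    intro n
    induction n with
    | zero => intro y r _; simp
    | succ n ih =>
      intro y r hr
      have h1 := (hD y (2 ^ n * r) (by positivity)).2.1
      rw [show (2 : ℝ) ^ (n + 1) * r = 2 * (2 ^ n * r) by ring]
      refine h1.trans ?_
      rw [pow_succ', mul_assoc]
      gcongr
      exact ih y r hr
  -- `B(x, s)` lies in `B(y, 2Λr)`, so `n` doublings with `2 ^ n > 2Λ` suffice.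
  obtain ⟨n, hn⟩ := pow_unbounded_of_one_lt (2 * Λ) (one_lt_two : (1 : ℝ) < 2)
  refine ⟨(Real.toNNReal D) ^ n, one_le_pow₀ (by simpa using hD1), fun x y r s hr hs hxy => ?_⟩
  have hsub : Metric.ball x s ⊆ Metric.ball y (2 ^ n * r) := by
    apply Metric.ball_subset_ball'
    nlinarith
  refine (measure_mono hsub).trans ((hpow n y r hr).trans_eq ?_)
  simp [ENNReal.ofReal]

theorem IsDoubling.isFiniteMeasure [CompactSpace X] (hν : IsDoubling d ν) : IsFiniteMeasure ν := by
  constructor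
  rcases isEmpty_or_nonempty X with hX | ⟨⟨x⟩⟩
  · simp [Set.univ_eq_empty_iff.2 hX]
  · obtain ⟨r, hr⟩ := (Metric.isBounded_of_compactSpace (s := (univ : Set X))).subset_ball x
    refine (measure_mono (hr.trans (Metric.ball_subset_ball (le_max_left r 1)))).trans_lt
      (hν.measure_ball_lt_top x (by positivity))

variable [BorelSpace X]

/-- Separated sets in a ball of comparable radius have boundedly many elements. -/
theorem IsDoubling.exists_card_le (hν : IsDoubling d ν) {Λ : ℝ} (hΛ : 0 ≤ Λ) :
    ∃ N : ℕ, ∀ (r : ℝ) (x : X) (s : Finset X), 0 < r →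
      (s : Set X).Pairwise (fun y z => r ≤ dist y z) →
      (∀ y ∈ s, dist y x < Λ * r) → s.card ≤ N := by
  -- The factor is the ratio of `(Λ + 1) r` to `r / 2`: the disjoint balls of radius `r / 2` lie in
  -- one ball of radius `(Λ + 1) r`, and each carries at least `1 / K` of its mass.
  obtain ⟨K, -, hK⟩ := hν.exists_measure_ball_le (2 * (Λ + 1))
  refine ⟨⌈K⌉₊, fun r x s hr hs hx => ?_⟩
  have hpos := hν.measure_ball_pos x (r := (Λ + 1) * r) (by positivity)
  have hfin := hν.measure_ball_lt_top x (r := (Λ + 1) * r) (by positivity)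
  have hdis : (s : Set X).PairwiseDisjoint (fun y => Metric.ball y (r / 2)) := by
    intro y hy z hz hyz
    exact Metric.ball_disjoint_ball (by linarith [hs hy hz hyz])
  have h1 : ∑ y ∈ s, ν (Metric.ball y (r / 2)) ≤ ν (Metric.ball x ((Λ + 1) * r)) := by
    rw [← measure_biUnion_finset hdis fun _ _ => Metric.isOpen_ball.measurableSet]
    refine measure_mono (iUnion₂_subset fun y hy => Metric.ball_subset_ball' ?_)
    linarith [hx y hy]
  have h2 : (s.card : ℝ≥0∞) * ν (Metric.ball x ((Λ + 1) * r)) ≤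
      K * ν (Metric.ball x ((Λ + 1) * r)) := by
    rw [← nsmul_eq_mul, ← Finset.sum_const]
    calc ∑ y ∈ s, ν (Metric.ball x ((Λ + 1) * r))
        ≤ ∑ y ∈ s, K * ν (Metric.ball y (r / 2)) := by
          refine Finset.sum_le_sum fun y hy => hK _ _ _ _ (by positivity) (by linarith) ?_
          rw [dist_comm]; nlinarith [hx y hy]
      _ ≤ _ := by rw [← Finset.mul_sum]; gcongr
  have h3 : (s.card : ℝ≥0∞) ≤ K := (ENNReal.mul_le_mul_iff_left hpos.ne' hfin.ne).1 h2
  have h4 : (s.card : ℝ≥0) ≤ K := by exact_mod_cast h3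
  exact_mod_cast h4.trans (Nat.le_ceil K)

/-- Existence of maximal separated sets. -/
theorem IsDoubling.exists_net [CompactSpace X] (hν : IsDoubling d ν) {r : ℝ} (hr : 0 < r) :
    ∃ s : Finset X, (s : Set X).Pairwise (fun y z => r ≤ dist y z) ∧
      ∀ x, ∃ y ∈ s, dist x y < r := by
  classical
  rcases isEmpty_or_nonempty X with hX | ⟨⟨x₀⟩⟩
  · exact ⟨∅, by simp, fun x => (hX.false x).elim⟩
  obtain ⟨R, hR⟩ := (Metric.isBounded_of_compactSpace (s := (univ : Set X))).subset_ball x₀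
  have hR0 : 0 < R := by simpa using hR (mem_univ x₀)
  obtain ⟨N, hN⟩ := hν.exists_card_le (Λ := R / r) (by positivity)
  let A : Set ℕ := {n | ∃ s : Finset X, (s : Set X).Pairwise (fun y z => r ≤ dist y z) ∧
    s.card = n}
  have hA : BddAbove A := by
    refine ⟨N, ?_⟩
    rintro n ⟨s, hs, rfl⟩
    refine hN r x₀ s hr hs fun y _ => ?_
    rw [div_mul_cancel₀ _ hr.ne']
    exact hR (mem_univ y)
  obtain ⟨s, hs, hcard⟩ := Nat.sSup_mem (s := A) ⟨0, ∅, by simp, by simp⟩ hA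
  refine ⟨s, hs, fun x => ?_⟩
  by_contra! h
  have hx : x ∉ s := fun hx => by simpa using (h x hx).trans_lt' hr
  have : (insert x s).card ∈ A := by
    refine ⟨insert x s, ?_, rfl⟩
    rw [Finset.coe_insert]
    refine hs.insert fun y hy _ => ⟨h y hy, ?_⟩
    rw [dist_comm]; exact h y hy
  have := le_csSup hA this
  rw [Finset.card_insert_of_notMem hx] at this
  omega

/-- Reverse doubling in connected spaces. -/
theorem IsDoubling.exists_reverse_doubling [CompactSpace X] [ConnectedSpace X]
    (hν : IsDoubling d ν) {M : ℝ} (hM : 0 < M) :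
    ∃ τ C : ℝ≥0, 0 < τ ∧ τ < 1 ∧ ∀ (x : X) (s : ℝ) (i : ℕ), 0 < s →
      s ≤ M * Metric.diam (univ : Set X) →
      ν (Metric.ball x (s / 4 ^ i)) ≤ C * τ ^ i * ν (Metric.ball x s) := by
  obtain ⟨K, hK1, hK⟩ := hν.exists_measure_ball_le 4
  have hb : Bornology.IsBounded (univ : Set X) := Metric.isBounded_of_compactSpace
  set A := Metric.diam (univ : Set X) with hA
  -- `K + 1` in place of `K` keeps `τ` positive when `K = 1`; positivity is needed to invert `τ ^ k`
  -- at the end.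
  obtain ⟨τ, hτ0, hτ1, hτ⟩ : ∃ τ : ℝ≥0, 0 < τ ∧ τ < 1 ∧ 1 - K⁻¹ ≤ τ := by
    refine ⟨1 - (K + 1)⁻¹, ?_, ?_, ?_⟩
    · rw [tsub_pos_iff_lt]; exact inv_lt_one_of_one_lt₀ (by linarith)
    · exact tsub_lt_self one_pos (by positivity)
    · exact tsub_le_tsub_left (inv_anti₀ (by linarith) (by linarith)) _
  -- Connectedness gives a point `z` at distance exactly `s / 2` from `x`. The ball of radius `s /
  -- 4` about `z` misses the one about `x` and takes a fixed share of the mass of `B(x, s)`.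
  have step : ∀ (x : X) (s : ℝ), 0 < s → s ≤ A / 2 →
      ν (Metric.ball x (s / 4)) ≤ τ * ν (Metric.ball x s) := by
    intro x s hs hsA
    obtain ⟨w, hw⟩ : ∃ w, s ≤ dist x w := by
      by_contra! h
      have : A < 2 * s := by
        -- The maximum is attained, so the strict inequality is uniform. This matters in the
        -- borderline case `s = A / 2`.
        obtain ⟨q, hq⟩ : ∃ q < s, ∀ y, dist x y ≤ q := by
          obtain ⟨y, -, hy⟩ := isCompact_univ.exists_isMaxOn (s := (univ : Set X)) univ_nonempty
            (f := fun y => dist x y) (by fun_prop)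
          exact ⟨_, h y, fun z => hy (mem_univ z)⟩
        have : A ≤ 2 * q := by
          refine Metric.diam_le_of_forall_dist_le ?_ fun y _ z _ => ?_
          · linarith [hq.2 x, dist_self x]
          · linarith [dist_triangle_left y z x, hq.2 y, hq.2 z]
        linarith
      linarith
    obtain ⟨z, hz⟩ : ∃ z, dist x z = s / 2 := by
      have := isPreconnected_univ (α := X) |>.intermediate_value (mem_univ x) (mem_univ w)
        (f := fun y => dist x y) (by fun_prop)
      obtain ⟨z, -, hz⟩ := this (show s / 2 ∈ Icc (dist x x) (dist x w) by
        constructor <;> [(rw [dist_self]; positivity); linarith])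
      exact ⟨z, hz⟩
    have hdisj : Disjoint (Metric.ball x (s / 4)) (Metric.ball z (s / 4)) :=
      Metric.ball_disjoint_ball (by linarith)
    have hsub : Metric.ball x (s / 4) ∪ Metric.ball z (s / 4) ⊆ Metric.ball x s := by
      refine union_subset (Metric.ball_subset_ball (by linarith)) (Metric.ball_subset_ball' ?_)
      rw [dist_comm]; linarith
    have h1 : ν (Metric.ball x (s / 4)) + ν (Metric.ball z (s / 4)) ≤ ν (Metric.ball x s) := by
      rw [← measure_union hdisj Metric.isOpen_ball.measurableSet]
      exact measure_mono hsub
    have h2 : ν (Metric.ball x s) ≤ K * ν (Metric.ball z (s / 4)) :=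
      hK _ _ _ _ (by positivity) (by linarith) (by linarith)
    have f1 := hν.measure_ball_lt_top x hs
    have f2 := hν.measure_ball_lt_top x (r := s / 4) (by positivity)
    have f3 := hν.measure_ball_lt_top z (r := s / 4) (by positivity)
    lift ν (Metric.ball x s) to ℝ≥0 using f1.ne with a
    lift ν (Metric.ball x (s / 4)) to ℝ≥0 using f2.ne with b
    lift ν (Metric.ball z (s / 4)) to ℝ≥0 using f3.ne with c
    norm_cast at h1 h2 ⊢
    have h3 : K⁻¹ * a ≤ c := by
      rw [inv_mul_le_iff₀ (by positivity)]; exact h2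
    have h4 : (1 : ℝ) ≤ τ + (K : ℝ)⁻¹ := by
      exact_mod_cast tsub_le_iff_right.1 hτ
    have h5 : (K : ℝ)⁻¹ * a ≤ c := by exact_mod_cast h3
    have h6 : (b : ℝ) + c ≤ a := by exact_mod_cast h1
    have : (b : ℝ) ≤ τ * a := by nlinarith [mul_le_mul_of_nonneg_right h4 a.2]
    exact_mod_cast this
  have iter : ∀ (i : ℕ) (x : X) (s : ℝ), 0 < s → s ≤ A / 2 →
      ν (Metric.ball x (s / 4 ^ i)) ≤ τ ^ i * ν (Metric.ball x s) := by
    intro i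
    induction i with
    | zero => intro x s _ _; simp
    | succ i ih =>
      intro x s hs hsA
      have h4 : s / 4 ^ i ≤ s := div_le_self hs.le (one_le_pow₀ (by norm_num))
      have := step x (s / 4 ^ i) (by positivity) (h4.trans hsA)
      rw [show s / 4 ^ (i + 1) = s / 4 ^ i / 4 by rw [pow_succ]; field_simp]
      refine this.trans ?_
      rw [pow_succ', mul_assoc]
      gcongr
      exact ih x s hs hsA
  -- After `k` shrinkings the radius is at most `A / 2`; the first `k` steps are paid for by the
  -- constant `τ ^ (-k)`.
  obtain ⟨k, hk⟩ := pow_unbounded_of_one_lt (2 * M) (by norm_num : (1 : ℝ) < 4)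
  refine ⟨τ, (τ ^ k)⁻¹, hτ0, hτ1, fun x s i hs hsA => ?_⟩
  rcases le_total k i with hki | hki
  · obtain ⟨j, rfl⟩ := Nat.exists_eq_add_of_le hki
    have hA0 : 0 ≤ A := Metric.diam_nonneg
    have h1 : s / 4 ^ k ≤ A / 2 := by
      rw [div_le_iff₀ (by positivity)]; nlinarith
    have h2 := iter j x (s / 4 ^ k) (by positivity) h1
    rw [div_div, ← pow_add] at h2
    refine h2.trans ?_
    rw [show ((τ ^ k)⁻¹ : ℝ≥0) * (τ : ℝ≥0∞) ^ (k + j) = (τ : ℝ≥0∞) ^ j by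
      norm_cast; rw [pow_add, inv_mul_cancel_left₀ (by positivity)]]
    gcongr
    exact div_le_self hs.le (one_le_pow₀ (by norm_num))
  · have : (1 : ℝ≥0∞) ≤ ((τ ^ k)⁻¹ : ℝ≥0) * (τ : ℝ≥0∞) ^ i := by
      norm_cast
      rw [le_inv_mul_iff₀ (by positivity), mul_one]
      exact pow_le_pow_of_le_one (by positivity) hτ1.le hki
    calc ν (Metric.ball x (s / 4 ^ i)) ≤ 1 * ν (Metric.ball x s) := by
          rw [one_mul]
          gcongr
          exact div_le_self hs.le (one_le_pow₀ (by norm_num))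
      _ ≤ _ := by gcongr

end Doubling

/-! ### Averages and integrals over balls -/

section Averages

/-- Jensen's inequality for averages of a continuous function. -/
theorem edist_setAverage_rpow_le {X : Type*} [TopologicalSpace X] [CompactSpace X]
    [MeasurableSpace X] [BorelSpace X] {μ : Measure X} [IsFiniteMeasure μ] {p : ℝ} (hp : 1 ≤ p)
    (f : C(X, ℝ)) (c : ℝ) {B : Set X} (hB : μ B ≠ 0) :
    edist (⨍ y in B, f y ∂μ) c ^ p ≤ (μ B)⁻¹ * ∫⁻ y in B, edist (f y) c ^ p ∂μ := by
  have hp0 : 0 ≤ p := by linarith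
  have hconv : ConvexOn ℝ univ fun t : ℝ => |t - c| ^ p := by
    refine ⟨convex_univ, fun x _ y _ a b ha hb hab => ?_⟩
    have h1 : |a • x + b • y - c| ≤ a • |x - c| + b • |y - c| := by
      have : a • x + b • y - c = a * (x - c) + b * (y - c) := by
        simp only [smul_eq_mul]; linear_combination c * hab
      rw [this, smul_eq_mul, smul_eq_mul]
      refine (abs_add_le _ _).trans_eq ?_
      rw [abs_mul, abs_mul, abs_of_nonneg ha, abs_of_nonneg hb]
    exact (Real.rpow_le_rpow (abs_nonneg _) h1 hp0).trans
      ((convexOn_rpow hp).2 (abs_nonneg (x - c)) (abs_nonneg (y - c)) ha hb hab)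
  have hcont : Continuous fun t : ℝ => |t - c| ^ p := by
    have := hp0
    fun_prop (disch := assumption)
  have hint : ∀ g : X → ℝ, Continuous g → Integrable g (μ.restrict B) := fun g hg =>
    (hg.integrable_of_hasCompactSupport (HasCompactSupport.of_compactSpace g)).integrableOn
  have hi := hint f f.continuous
  have hi' := hint (fun y => |f y - c| ^ p) (hcont.comp f.continuous)
  have key := hconv.map_set_average_le hcont.continuousOn isClosed_univ hB (measure_ne_top μ B)
    (by simp) hi hi'
  have e : ∀ t : ℝ, edist t c ^ p = ENNReal.ofReal (|t - c| ^ p) := fun t => by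
    rw [edist_dist, Real.dist_eq, ENNReal.ofReal_rpow_of_nonneg (abs_nonneg _) hp0]
  simp_rw [e]
  refine (ENNReal.ofReal_le_ofReal key).trans_eq ?_
  rw [ofReal_average hi' (ae_of_all _ fun y => by positivity), Measure.restrict_apply_univ,
    ENNReal.div_eq_inv_mul]

/-- The average of a continuous function is close to its values. -/
theorem dist_setAverage_le {X : Type*} [TopologicalSpace X] [CompactSpace X]
    [MeasurableSpace X] [BorelSpace X] {μ : Measure X} [IsFiniteMeasure μ]
    (f : C(X, ℝ)) (c ε : ℝ) {B : Set X} (hBm : MeasurableSet B) (hB : μ B ≠ 0)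
    (h : ∀ y ∈ B, dist (f y) c ≤ ε) :
    dist (⨍ y in B, f y ∂μ) c ≤ ε := by
  have hi : Integrable f (μ.restrict B) :=
    (f.continuous.integrable_of_hasCompactSupport
      (HasCompactSupport.of_compactSpace f)).integrableOn
  exact (convex_closedBall c ε).set_average_mem Metric.isClosed_closedBall hB (measure_ne_top μ B)
    ((ae_restrict_iff' hBm).2 (ae_of_all _ h)) hi

variable {X : Type*} [d : MetricSpace X] [MeasurableSpace X] [BorelSpace X]

theorem measurable_measure_ball [CompactSpace X] (ν : Measure X) [IsFiniteMeasure ν] (r : ℝ) :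
    Measurable fun x => ν (Metric.ball x r) := by
  have h : MeasurableSet {q : X × X | dist q.2 q.1 < r} :=
    (isOpen_lt (by fun_prop) continuous_const).measurableSet
  exact measurable_measure_prodMk_left h

/-- Fubini's theorem for integrals over moving balls. -/
theorem lintegral_setLIntegral_ball [CompactSpace X] (ν Γ : Measure X) [IsFiniteMeasure ν]
    [IsFiniteMeasure Γ] {g : X → ℝ≥0∞} (hg : Measurable g) (t : ℝ) :
    ∫⁻ x, ∫⁻ y in Metric.ball x t, g y ∂Γ ∂ν = ∫⁻ y, g y * ν (Metric.ball y t) ∂Γ := by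
  have h : MeasurableSet {q : X × X | dist q.2 q.1 < t} :=
    (isOpen_lt (by fun_prop) continuous_const).measurableSet
  have h1 : ∀ x, ∫⁻ y in Metric.ball x t, g y ∂Γ =
      ∫⁻ y, {q : X × X | dist q.2 q.1 < t}.indicator (fun q => g q.2) (x, y) ∂Γ := fun x => by
    rw [← lintegral_indicator Metric.isOpen_ball.measurableSet]
    rfl
  simp_rw [h1]
  rw [lintegral_lintegral_swap (f := fun x y =>
      {q : X × X | dist q.2 q.1 < t}.indicator (fun q => g q.2) (x, y))
    (((hg.comp measurable_snd).indicator h).aemeasurable)]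
  refine lintegral_congr fun y => ?_
  rw [← lintegral_indicator_const Metric.isOpen_ball.measurableSet]
  refine lintegral_congr fun x => ?_
  simp [indicator, dist_comm]

end Averages

end ConfInv
end

noncomputable section

namespace ConfInv

/-! ### Elementary inequalities for powers -/

theorem rpow_add_le_two_rpow {p : ℝ} (hp : 1 ≤ p) (a b : ℝ≥0∞) :
    (a + b) ^ p ≤ 2 ^ p * (a ^ p + b ^ p) := by
  refine (ENNReal.rpow_add_le_mul_rpow_add_rpow a b hp).trans ?_
  gcongr
  · norm_num
  · linarith

theorem inv_le_mul_inv_of_le_mul {K : ℝ≥0} (hK : 1 ≤ K) {a b : ℝ≥0∞} (h : a ≤ K * b) :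
    b⁻¹ ≤ K * a⁻¹ := by
  have hK0 : (K : ℝ≥0∞) ≠ 0 := by exact_mod_cast (zero_lt_one.trans_le hK).ne'
  rw [← ENNReal.inv_le_inv, ENNReal.mul_inv (Or.inl hK0) (by simp)] at h
  calc b⁻¹ = (K : ℝ≥0∞) * ((K : ℝ≥0∞)⁻¹ * b⁻¹) := by
        rw [← mul_assoc, ENNReal.mul_inv_cancel hK0 (by simp), one_mul]
    _ ≤ _ := by gcongr

/-- A weighted power inequality for series. -/
theorem exists_tsum_rpow_le {p : ℝ} (hp : 0 < p) {σ : ℝ≥0} (hσ0 : 0 < σ) (hσ1 : σ < 1) :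
    ∃ S : ℝ≥0, ∀ b : ℕ → ℝ≥0∞,
      (∑' i, b i) ^ p ≤ S * ∑' i, ((σ⁻¹ : ℝ≥0) : ℝ≥0∞) ^ i * b i ^ p := by
  -- Instead of Hölder: each `b i` is at most `θ ^ i * T ^ (1 / p)`, and the geometric series is
  -- summed.
  set θ : ℝ≥0 := σ ^ (1 / p) with hθ
  have hθ1 : θ < 1 := NNReal.rpow_lt_one hσ1 (by positivity)
  refine ⟨((1 - θ)⁻¹) ^ p, fun b => ?_⟩
  set T := ∑' i, ((σ⁻¹ : ℝ≥0) : ℝ≥0∞) ^ i * b i ^ p with hT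
  have hb : ∀ i, b i ≤ (θ : ℝ≥0∞) ^ i * T ^ (1 / p) := by
    intro i
    have h1 : ((σ⁻¹ : ℝ≥0) : ℝ≥0∞) ^ i * b i ^ p ≤ T := ENNReal.le_tsum i
    have h2 : b i ^ p ≤ (σ : ℝ≥0∞) ^ i * T := by
      calc b i ^ p = (σ : ℝ≥0∞) ^ i * (((σ⁻¹ : ℝ≥0) : ℝ≥0∞) ^ i * b i ^ p) := by
            rw [← mul_assoc, ← mul_pow, ← ENNReal.coe_mul, mul_inv_cancel₀ hσ0.ne']
            simp
        _ ≤ _ := by gcongr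
    have h3 : b i ≤ ((σ : ℝ≥0∞) ^ i * T) ^ (1 / p) := by
      rw [one_div]; exact (ENNReal.le_rpow_inv_iff hp).2 h2
    refine h3.trans_eq ?_
    rw [ENNReal.mul_rpow_of_nonneg _ _ (by positivity), hθ,
      ENNReal.coe_rpow_of_nonneg _ (by positivity), ← ENNReal.rpow_natCast, ← ENNReal.rpow_natCast,
      ← ENNReal.rpow_mul, ← ENNReal.rpow_mul, mul_comm (i : ℝ)]
  calc (∑' i, b i) ^ p ≤ (∑' i, (θ : ℝ≥0∞) ^ i * T ^ (1 / p)) ^ p := by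
        gcongr; exact hb _
    _ = (((1 - θ)⁻¹ : ℝ≥0) : ℝ≥0∞) ^ p * T := by
        rw [ENNReal.tsum_mul_right, ENNReal.tsum_geometric, ENNReal.mul_rpow_of_nonneg _ _ hp.le,
          ← ENNReal.rpow_mul, one_div_mul_cancel hp.ne', ENNReal.rpow_one,
          ENNReal.coe_inv (tsub_pos_of_lt hθ1).ne', ENNReal.coe_sub, ENNReal.coe_one]
    _ = _ := by rw [ENNReal.coe_rpow_of_nonneg _ hp.le]

theorem ball_eq_univ_of_diam_lt {X : Type*} [MetricSpace X] [CompactSpace X]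
    {r : ℝ} (hr : Metric.diam (univ : Set X) < r) (x : X) :
    Metric.ball x r = univ :=
  eq_univ_of_forall fun y => (Metric.dist_le_diam_of_mem
    Metric.isBounded_of_compactSpace (mem_univ y) (mem_univ x)).trans_lt hr

theorem diam_univ_pos {X : Type*} [MetricSpace X] [CompactSpace X] [Nontrivial X] : 0 < Metric.diam (univ : Set X) := by
  obtain ⟨x, y, hxy⟩ := exists_pair_ne X
  exact (dist_pos.2 hxy).trans_le (Metric.dist_le_diam_of_mem
    Metric.isBounded_of_compactSpace (mem_univ x) (mem_univ y))

/-! ### The Korevaar–Schoen energy of a function satisfying a Poincaré inequality -/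

section Poincare

variable {X : Type*} [d : MetricSpace X] [MeasurableSpace X]

/-- The Korevaar–Schoen type energy at the scale `r`. -/
def ksEnergyAt (p : ℝ) (ν : Measure X) (f : X → ℝ) (r : ℝ) : ℝ≥0∞ :=
  ∫⁻ x, (⨍⁻ y in Metric.ball x r, edist (f x) (f y) ^ p / ν (Metric.ball x r) ∂ν) ∂ν

/-- The Korevaar–Schoen type energy. -/
def ksEnergy (p : ℝ) (ν : Measure X) (f : X → ℝ) : ℝ≥0∞ :=
  ⨆ (r : ℝ) (_ : 0 < r), ksEnergyAt p ν f r

/-- A Poincaré inequality for a function with energy measure `Γ`, in conformally invariant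
form. -/
def Poincare (μ Γ : Measure X) (p : ℝ) (C : ℝ≥0) (Λ : ℝ) (f : X → ℝ) : Prop :=
  ∀ (x : X) (s : ℝ), 0 < s → ∃ c : ℝ,
    ∫⁻ y in Metric.ball x s, edist (f y) c ^ p ∂μ ≤
      C * μ (Metric.ball x s) * Γ (Metric.ball x (Λ * s))

variable [BorelSpace X] [CompactSpace X] {μ ν : Measure X}

/-- Under a Poincaré inequality, averages over comparable balls are close to each other. -/
theorem IsDoubling.exists_edist_average_le (hμ : IsDoubling d μ) {p : ℝ} (hp : 1 ≤ p)
    (C : ℝ≥0) (Λ : ℝ) :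
    ∃ K : ℝ≥0, ∀ (f : C(X, ℝ)) (Γ : Measure X), Poincare μ Γ p C Λ f →
      ∀ (x y₁ y₂ : X) (s t₁ t₂ : ℝ), 0 < s → s ≤ 4 * t₁ → s ≤ 4 * t₂ →
        Metric.ball y₁ t₁ ⊆ Metric.ball x s → Metric.ball y₂ t₂ ⊆ Metric.ball x s →
        edist (⨍ z in Metric.ball y₁ t₁, f z ∂μ) (⨍ z in Metric.ball y₂ t₂, f z ∂μ) ^ p ≤
          K * Γ (Metric.ball x (Λ * s)) := by
  have := hμ.isFiniteMeasure
  obtain ⟨K, -, hK⟩ := hμ.exists_measure_ball_le 4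
  have hp0 : 0 ≤ p := by linarith
  refine ⟨2 ^ p * (2 * (K * C)), fun f Γ hf x y₁ y₂ s t₁ t₂ hs h1 h2 hb1 hb2 => ?_⟩
  obtain ⟨c, hc⟩ := hf x s hs
  -- Both averages are compared with the same constant `c` of the large ball, by Jensen and `μ (B(x,
  -- s)) ≤ K μ (B(y, t))`.
  have key : ∀ (y : X) (t : ℝ), s ≤ 4 * t → Metric.ball y t ⊆ Metric.ball x s →
      edist (⨍ z in Metric.ball y t, f z ∂μ) c ^ p ≤ K * C * Γ (Metric.ball x (Λ * s)) := by
    intro y t hst hb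
    have ht : 0 < t := by linarith
    have hyx : dist y x < s := hb (Metric.mem_ball_self ht)
    have hpos := hμ.measure_ball_pos y ht
    have hfin := hμ.measure_ball_lt_top y ht
    have hle := hK x y t s ht hst (by rw [dist_comm]; linarith)
    refine (edist_setAverage_rpow_le hp f c hpos.ne').trans ?_
    calc (μ (Metric.ball y t))⁻¹ * ∫⁻ z in Metric.ball y t, edist (f z) c ^ p ∂μ
        ≤ (μ (Metric.ball y t))⁻¹ * (C * (K * μ (Metric.ball y t)) *
            Γ (Metric.ball x (Λ * s))) := by
          gcongr
          refine (lintegral_mono_set hb).trans (hc.trans ?_)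
          gcongr
      _ = (μ (Metric.ball y t))⁻¹ * μ (Metric.ball y t) *
            (K * C * Γ (Metric.ball x (Λ * s))) := by ring
      _ = _ := by rw [ENNReal.inv_mul_cancel hpos.ne' hfin.ne, one_mul]
  calc _ ≤ (edist (⨍ z in Metric.ball y₁ t₁, f z ∂μ) c +
        edist (⨍ z in Metric.ball y₂ t₂, f z ∂μ) c) ^ p := by
        gcongr; exact edist_triangle_right _ _ _
    _ ≤ 2 ^ p * (K * C * Γ (Metric.ball x (Λ * s)) + K * C * Γ (Metric.ball x (Λ * s))) := by
        refine (rpow_add_le_two_rpow hp _ _).trans ?_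
        gcongr
        · exact key _ _ h1 hb1
        · exact key _ _ h2 hb2
    _ = _ := by
        push_cast
        rw [ENNReal.coe_rpow_of_nonneg _ hp0]
        push_cast
        ring

/-- Telescoping over shrinking balls. -/
theorem IsDoubling.exists_edist_average_self_le (hμ : IsDoubling d μ) {p : ℝ} (hp : 1 ≤ p)
    (C : ℝ≥0) (Λ : ℝ) {σ : ℝ≥0} (hσ0 : 0 < σ) (hσ1 : σ < 1) :
    ∃ K : ℝ≥0, ∀ (f : C(X, ℝ)) (Γ : Measure X), Poincare μ Γ p C Λ f →
      ∀ (x : X) (s : ℝ), 0 < s →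
        edist (⨍ z in Metric.ball x s, f z ∂μ) (f x) ^ p ≤
          K * ∑' i : ℕ, ((σ⁻¹ : ℝ≥0) : ℝ≥0∞) ^ i * Γ (Metric.ball x (Λ * s / 4 ^ i)) := by
  have := hμ.isFiniteMeasure
  obtain ⟨K, hK⟩ := hμ.exists_edist_average_le hp C Λ
  obtain ⟨S, hS⟩ := exists_tsum_rpow_le (p := p) (by linarith) hσ0 hσ1
  refine ⟨S * K, fun f Γ hf x s hs => ?_⟩
  set m : ℕ → ℝ := fun i => ⨍ z in Metric.ball x (s / 4 ^ i), f z ∂μ with hm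
  -- Continuity gives convergence at every `x`; convergence `μ`-a.e. would be useless for
  -- integration against `ν`.
  have hlim : Tendsto m atTop (𝓝 (f x)) := by
    rw [Metric.tendsto_atTop]
    intro ε hε
    obtain ⟨δ, hδ, h⟩ := Metric.continuous_iff.1 f.continuous x (ε / 2) (by positivity)
    have ht : Tendsto (fun i : ℕ => s / 4 ^ i) atTop (𝓝 0) := by
      have := (tendsto_pow_atTop_nhds_zero_of_lt_one (r := (4 : ℝ)⁻¹) (by norm_num)
        (by norm_num)).const_mul s
      simpa [div_eq_mul_inv] using this
    obtain ⟨N, hN⟩ := eventually_atTop.1 (ht.eventually (gt_mem_nhds hδ))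
    refine ⟨N, fun n hn => lt_of_le_of_lt (b := ε / 2) ?_ (by linarith)⟩
    refine dist_setAverage_le f (f x) (ε / 2) Metric.isOpen_ball.measurableSet
      (hμ.measure_ball_pos x (by positivity)).ne' fun y hy => (h y ?_).le
    exact (Metric.mem_ball.1 hy).trans (hN n hn)
  have h1 := edist_le_tsum_of_edist_le_of_tendsto₀ (f := m) (fun i => edist (m i) (m (i + 1)))
    (fun i => le_rfl) hlim
  have h0 : m 0 = ⨍ z in Metric.ball x s, f z ∂μ := by simp [hm]
  rw [h0] at h1
  calc _ ≤ (∑' i, edist (m i) (m (i + 1))) ^ p := by gcongr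
    _ ≤ S * ∑' i, ((σ⁻¹ : ℝ≥0) : ℝ≥0∞) ^ i * edist (m i) (m (i + 1)) ^ p := hS _
    _ ≤ S * ∑' i, ((σ⁻¹ : ℝ≥0) : ℝ≥0∞) ^ i * (K * Γ (Metric.ball x (Λ * s / 4 ^ i))) := by
        gcongr with i
        have hsi : 0 < s / 4 ^ i := by positivity
        have e : s / 4 ^ (i + 1) = s / 4 ^ i / 4 := by rw [pow_succ]; field_simp
        rw [mul_div_assoc]
        refine hK f Γ hf x x x _ _ _ hsi (by linarith) (by rw [e]; linarith) le_rfl ?_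
        exact Metric.ball_subset_ball (by rw [e]; linarith)
    _ = _ := by
        simp_rw [mul_left_comm _ (K : ℝ≥0∞), ENNReal.tsum_mul_left]
        push_cast
        ring

/-- Integrated form of the reverse doubling property. -/
theorem IsDoubling.exists_lintegral_inv_mul_le [ConnectedSpace X] (hν : IsDoubling d ν)
    {Λ : ℝ} (hΛ : 1 ≤ Λ) :
    ∃ τ C : ℝ≥0, 0 < τ ∧ τ < 1 ∧ ∀ (Γ : Measure X) [IsFiniteMeasure Γ] (s : ℝ) (i : ℕ), 0 < s →
      s ≤ 2 * Metric.diam (univ : Set X) →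
      ∫⁻ x, (ν (Metric.ball x s))⁻¹ * Γ (Metric.ball x (Λ * s / 4 ^ i)) ∂ν ≤
        C * τ ^ i * Γ univ := by
  have := hν.isFiniteMeasure
  obtain ⟨K, hK1, hK⟩ := hν.exists_measure_ball_le Λ
  obtain ⟨τ, C, hτ0, hτ1, h⟩ := hν.exists_reverse_doubling (M := Λ * 2) (by positivity)
  refine ⟨τ, K * C, hτ0, hτ1, fun Γ _ s i hs hsd => ?_⟩
  have hm : Measurable fun y => (K : ℝ≥0∞) * (ν (Metric.ball y (Λ * s)))⁻¹ :=
    (measurable_measure_ball ν _).inv.const_mul _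
  -- The weight is moved from `x` to the integration variable `y`, so that Fubini leaves a quotient
  -- of `ν`-measures of balls centred at `y`.
  calc _ ≤ ∫⁻ x, ∫⁻ y in Metric.ball x (Λ * s / 4 ^ i),
        K * (ν (Metric.ball y (Λ * s)))⁻¹ ∂Γ ∂ν := by
        refine lintegral_mono fun x => ?_
        rw [← setLIntegral_const]
        refine setLIntegral_mono hm fun y hy => ?_
        have hyx : dist y x ≤ Λ * s := (Metric.mem_ball.1 hy).le.trans
          (div_le_self (by positivity) (one_le_pow₀ (by norm_num)))
        exact inv_le_mul_inv_of_le_mul hK1 (hK y x s (Λ * s) hs le_rfl hyx)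
    _ = ∫⁻ y, K * (ν (Metric.ball y (Λ * s)))⁻¹ * ν (Metric.ball y (Λ * s / 4 ^ i)) ∂Γ :=
        lintegral_setLIntegral_ball ν Γ hm _
    _ ≤ ∫⁻ y, K * C * τ ^ i ∂Γ := by
        refine lintegral_mono fun y => ?_
        have hΛs : 0 < Λ * s := by positivity
        have h1 := h y (Λ * s) i hΛs (by nlinarith)
        calc _ ≤ K * (ν (Metric.ball y (Λ * s)))⁻¹ *
              (C * τ ^ i * ν (Metric.ball y (Λ * s))) := by gcongr
          _ = K * C * τ ^ i * ((ν (Metric.ball y (Λ * s)))⁻¹ * ν (Metric.ball y (Λ * s))) := by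
              ring
          _ ≤ K * C * τ ^ i * 1 := by gcongr; exact ENNReal.inv_mul_le_one _
          _ = _ := mul_one _
    _ = _ := by rw [lintegral_const]; push_cast; ring

/-- By doubling both weights can be evaluated at `y` instead of `x`. Fubini then produces a factor
`ν (B(y, s))`, which cancels one of them. -/
theorem IsDoubling.exists_lintegral_inv_mul_inv_mul_le (hν : IsDoubling d ν) :
    ∃ C : ℝ≥0, ∀ (s : ℝ) (g : X → ℝ≥0∞), 0 < s → Measurable g →
      ∫⁻ x, (ν (Metric.ball x s))⁻¹ * ((ν (Metric.ball x s))⁻¹ *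
        ∫⁻ y in Metric.ball x s, g y ∂ν) ∂ν ≤ C * ∫⁻ x, (ν (Metric.ball x s))⁻¹ * g x ∂ν := by
  have := hν.isFiniteMeasure
  obtain ⟨K, hK1, hK⟩ := hν.exists_measure_ball_le 1
  refine ⟨K * K, fun s g hs hg => ?_⟩
  set w : X → ℝ≥0∞ := fun x => (ν (Metric.ball x s))⁻¹ with hw
  have hwm : Measurable w := (measurable_measure_ball ν _).inv
  have hwle : ∀ x y, dist y x ≤ s → w x ≤ K * w y := by
    intro x y hyx
    exact inv_le_mul_inv_of_le_mul hK1 (hK y x s s hs (by linarith) (by linarith))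
  have hm : Measurable fun y => (K * w y) * ((K * w y) * g y) := by fun_prop
  calc _ ≤ ∫⁻ x, ∫⁻ y in Metric.ball x s, (K * w y) * ((K * w y) * g y) ∂ν ∂ν := by
        refine lintegral_mono fun x => ?_
        rw [← lintegral_const_mul _ hg, ← lintegral_const_mul _ (hg.const_mul _)]
        refine setLIntegral_mono hm fun y hy => ?_
        have := hwle x y (Metric.mem_ball.1 hy).le
        gcongr
    _ = ∫⁻ y, (K * w y) * ((K * w y) * g y) * ν (Metric.ball y s) ∂ν :=
        lintegral_setLIntegral_ball ν ν hm _
    _ ≤ ∫⁻ y, (K * K) * (w y * g y) ∂ν := by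
        refine lintegral_mono fun y => ?_
        calc _ = K * K * (w y * g y) * (w y * ν (Metric.ball y s)) := by ring
          _ ≤ K * K * (w y * g y) * 1 := by gcongr; exact ENNReal.inv_mul_le_one _
          _ = _ := mul_one _
    _ = _ := by rw [lintegral_const_mul _ (by fun_prop)]; push_cast; rfl

/-- Integrated deviation of a function from its averages at a fixed scale. -/
theorem IsDoubling.exists_deviation_bound [ConnectedSpace X] (hμ : IsDoubling d μ)
    (hν : IsDoubling d ν) {p : ℝ} (hp : 1 ≤ p) (C : ℝ≥0) {Λ : ℝ} (hΛ : 1 ≤ Λ) :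
    ∃ K : ℝ≥0, ∀ (f : C(X, ℝ)) (Γ : Measure X) [IsFiniteMeasure Γ], Poincare μ Γ p C Λ f →
      ∀ s : ℝ, 0 < s → s ≤ 2 * Metric.diam (univ : Set X) →
        ∃ G : X → ℝ≥0∞, Measurable G ∧
          (∀ x, edist (⨍ z in Metric.ball x s, f z ∂μ) (f x) ^ p ≤ G x) ∧
          ∫⁻ x, (ν (Metric.ball x s))⁻¹ * G x ∂ν ≤ K * Γ univ := by
  have := hν.isFiniteMeasure
  obtain ⟨τ, A, hτ0, hτ1, hA⟩ := hν.exists_lintegral_inv_mul_le hΛ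
  -- Telescoping costs `σ ^ (-i)` and reverse doubling gains `τ ^ i`; with `σ = √τ` a summable `σ ^
  -- i` remains.
  set σ := NNReal.sqrt τ with hσ
  have hσ0 : 0 < σ := NNReal.sqrt_pos.2 hτ0
  have hσ1 : σ < 1 := by rw [hσ, ← NNReal.sqrt_one]; exact NNReal.sqrt_lt_sqrt.2 hτ1
  have hστ : σ⁻¹ * τ = σ := by
    rw [← NNReal.mul_self_sqrt τ, inv_mul_cancel_left₀ hσ0.ne']
  obtain ⟨K, hK⟩ := hμ.exists_edist_average_self_le hp C Λ hσ0 hσ1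
  refine ⟨K * A * (1 - σ)⁻¹, fun f Γ _ hf s hs hsd => ?_⟩
  have hmi : ∀ i : ℕ, Measurable fun x => ((σ⁻¹ : ℝ≥0) : ℝ≥0∞) ^ i *
      Γ (Metric.ball x (Λ * s / 4 ^ i)) := fun i => (measurable_measure_ball Γ _).const_mul _
  have hwm : Measurable fun x => (ν (Metric.ball x s))⁻¹ := (measurable_measure_ball ν _).inv
  -- The series serves as a measurable majorant, so measurability of the averages in `x` is never
  -- needed.
  refine ⟨fun x => K * ∑' i : ℕ, ((σ⁻¹ : ℝ≥0) : ℝ≥0∞) ^ i * Γ (Metric.ball x (Λ * s / 4 ^ i)),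
    (Measurable.tsum hmi).const_mul _, fun x => hK f Γ hf x s hs, ?_⟩
  calc _ = ∫⁻ x, K * ∑' i : ℕ, ((σ⁻¹ : ℝ≥0) : ℝ≥0∞) ^ i * ((ν (Metric.ball x s))⁻¹ *
        Γ (Metric.ball x (Λ * s / 4 ^ i))) ∂ν := by
        refine lintegral_congr fun x => ?_
        rw [mul_left_comm, ← ENNReal.tsum_mul_left]
        simp_rw [mul_left_comm (ν (Metric.ball x s))⁻¹]
    _ = K * ∑' i : ℕ, ((σ⁻¹ : ℝ≥0) : ℝ≥0∞) ^ i * ∫⁻ x, (ν (Metric.ball x s))⁻¹ *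
        Γ (Metric.ball x (Λ * s / 4 ^ i)) ∂ν := by
        have hmi' : ∀ i : ℕ, Measurable fun x => (ν (Metric.ball x s))⁻¹ *
          Γ (Metric.ball x (Λ * s / 4 ^ i)) := fun i => hwm.mul (measurable_measure_ball Γ _)
        rw [lintegral_const_mul _ (Measurable.tsum fun i => (hmi' i).const_mul _),
          lintegral_tsum fun i => ((hmi' i).const_mul _).aemeasurable]
        simp_rw [lintegral_const_mul _ (hmi' _)]
    _ ≤ K * ∑' i : ℕ, ((σ⁻¹ : ℝ≥0) : ℝ≥0∞) ^ i * (A * τ ^ i * Γ univ) := by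
        gcongr with i
        exact hA Γ s i hs hsd
    _ = K * ∑' i : ℕ, (σ : ℝ≥0∞) ^ i * (A * Γ univ) := by
        congr 2 with i
        rw [show ((σ⁻¹ : ℝ≥0) : ℝ≥0∞) ^ i * (A * τ ^ i * Γ univ) =
          (((σ⁻¹ : ℝ≥0) : ℝ≥0∞) * τ) ^ i * (A * Γ univ) by rw [mul_pow]; ring,
          ← ENNReal.coe_mul, hστ]
    _ = _ := by
        rw [ENNReal.tsum_mul_right, ENNReal.tsum_geometric]
        push_cast [ENNReal.coe_inv (tsub_pos_of_lt hσ1).ne', ENNReal.coe_sub]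
        ring

/-- Under a Poincaré inequality, the Korevaar–Schoen energy with respect to an arbitrary
doubling measure is controlled by the total energy. -/
theorem IsDoubling.exists_ksEnergy_le [ConnectedSpace X] [Nontrivial X] (hμ : IsDoubling d μ)
    (hν : IsDoubling d ν) {p : ℝ} (hp : 1 ≤ p) (C : ℝ≥0) {Λ : ℝ} (hΛ : 1 ≤ Λ) :
    ∃ K : ℝ≥0, ∀ (f : C(X, ℝ)) (Γ : Measure X) [IsFiniteMeasure Γ], Poincare μ Γ p C Λ f →
      ksEnergy p ν f ≤ K * Γ univ := by
  have := hν.isFiniteMeasure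
  obtain ⟨K₁, hK₁⟩ := hμ.exists_deviation_bound hν hp C hΛ
  obtain ⟨K₂, hK₂⟩ := hμ.exists_edist_average_le hp C Λ
  -- For `y ∈ B(x, r)` the averages at `x` and `y` are compared inside `B(x, 2r)`, hence the factor
  -- `2`.
  obtain ⟨τ, K₃, -, -, hK₃⟩ := hν.exists_lintegral_inv_mul_le (Λ := 2 * Λ) (by linarith)
  obtain ⟨K₄, hK₄⟩ := hν.exists_lintegral_inv_mul_inv_mul_le
  set P : ℝ≥0 := 2 ^ p with hP
  have hPe : (P : ℝ≥0∞) = 2 ^ p := by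
    rw [hP, ENNReal.coe_rpow_of_nonneg _ (by linarith)]; rfl
  refine ⟨P * (K₁ + P * (K₂ * K₃ + K₄ * K₁)), fun f Γ _ hf => ?_⟩
  have main : ∀ r : ℝ, 0 < r → r ≤ 2 * Metric.diam (univ : Set X) →
      ksEnergyAt p ν f r ≤ (P * (K₁ + P * (K₂ * K₃ + K₄ * K₁)) : ℝ≥0) * Γ univ := by
    intro r hr hrd
    obtain ⟨G, hGm, hG, hGi⟩ := hK₁ f Γ hf r hr hrd
    set w : X → ℝ≥0∞ := fun x => (ν (Metric.ball x r))⁻¹ with hw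
    have hwm : Measurable w := (measurable_measure_ball ν _).inv
    have hwν : ∀ x, w x * ν (Metric.ball x r) ≤ 1 := fun x => ENNReal.inv_mul_le_one _
    set H : X → ℝ≥0∞ := fun x => K₂ * Γ (Metric.ball x (2 * Λ * r)) with hH
    have hHm : Measurable H := (measurable_measure_ball Γ _).const_mul _
    have hpt : ∀ x, ∀ y ∈ Metric.ball x r,
        edist (f x) (f y) ^ p ≤ P * (G x + P * (H x + G y)) := by
      intro x y hy
      have h1 : edist (f x) (f y) ≤ edist (⨍ z in Metric.ball x r, f z ∂μ) (f x) +
          (edist (⨍ z in Metric.ball x r, f z ∂μ) (⨍ z in Metric.ball y r, f z ∂μ) +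
            edist (⨍ z in Metric.ball y r, f z ∂μ) (f y)) := by
        rw [edist_comm (⨍ z in Metric.ball x r, f z ∂μ) (f x)]
        exact (edist_triangle _ _ _).trans (add_le_add le_rfl (edist_triangle _ _ _))
      calc _ ≤ _ := ENNReal.rpow_le_rpow h1 (by linarith)
        _ ≤ _ := rpow_add_le_two_rpow hp _ _
        _ ≤ _ := by
          rw [hPe]
          gcongr
          · exact hG x
          · refine (rpow_add_le_two_rpow hp _ _).trans ?_
            gcongr
            · rw [show H x = K₂ * Γ (Metric.ball x (Λ * (2 * r))) by
                rw [hH]; simp only; congr 3; ring]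
              refine hK₂ f Γ hf x x y (2 * r) r r (by positivity) (by linarith) (by linarith)
                (Metric.ball_subset_ball (by linarith)) (Metric.ball_subset_ball' ?_)
              linarith [Metric.mem_ball.1 hy]
            · exact hG y
    calc ksEnergyAt p ν f r
        ≤ ∫⁻ x, (P * (w x * G x + P * (w x * H x)) +
            P * P * (w x * (w x * ∫⁻ y in Metric.ball x r, G y ∂ν))) ∂ν := by
          refine lintegral_mono fun x => ?_
          rw [setLAverage_eq, ENNReal.div_eq_inv_mul]
          simp_rw [ENNReal.div_eq_inv_mul]
          calc _ ≤ w x * ∫⁻ y in Metric.ball x r, w x * (P * (G x + P * H x) + P * P * G y) ∂ν := by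
                change w x * _ ≤ _
                refine mul_le_mul' le_rfl ?_
                refine setLIntegral_mono (g := fun y => w x * (P * (G x + P * H x) + P * P * G y))
                  (by fun_prop) fun y hy => ?_
                change w x * _ ≤ w x * _
                gcongr
                exact (hpt x y hy).trans_eq (by ring)
            _ = w x * (w x * (P * (G x + P * H x) * ν (Metric.ball x r) +
                P * P * ∫⁻ y in Metric.ball x r, G y ∂ν)) := by
                rw [lintegral_const_mul _ (by fun_prop), lintegral_add_left (by fun_prop),
                  setLIntegral_const, lintegral_const_mul _ hGm]
            _ = (w x * ν (Metric.ball x r)) * (P * (w x * G x + P * (w x * H x))) +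
                P * P * (w x * (w x * ∫⁻ y in Metric.ball x r, G y ∂ν)) := by ring
            _ ≤ 1 * (P * (w x * G x + P * (w x * H x))) +
                P * P * (w x * (w x * ∫⁻ y in Metric.ball x r, G y ∂ν)) := by
                gcongr; exact hwν x
            _ = _ := by rw [one_mul]
      _ = P * (∫⁻ x, w x * G x ∂ν + P * ∫⁻ x, w x * H x ∂ν) +
            P * P * ∫⁻ x, w x * (w x * ∫⁻ y in Metric.ball x r, G y ∂ν) ∂ν := by
          rw [lintegral_add_left (by fun_prop), lintegral_const_mul _ (by fun_prop),
            lintegral_add_left (by fun_prop), lintegral_const_mul _ (by fun_prop),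
            lintegral_const_mul' _ _ (by rw [← ENNReal.coe_mul]; exact ENNReal.coe_ne_top)]
      _ ≤ P * (K₁ * Γ univ + P * (K₂ * (K₃ * Γ univ))) + P * P * (K₄ * (K₁ * Γ univ)) := by
          gcongr
          · rw [show ∫⁻ x, w x * H x ∂ν = K₂ * ∫⁻ x, w x * Γ (Metric.ball x (2 * Λ * r)) ∂ν by
              rw [← lintegral_const_mul _ (show Measurable fun x => w x * Γ (Metric.ball x (2 * Λ * r))
                from hwm.mul (measurable_measure_ball Γ _))]
              exact lintegral_congr fun x => by simp only [hH]; ring]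
            gcongr
            simpa using hK₃ Γ r 0 hr hrd
          · refine (hK₄ r G hr hGm).trans ?_
            gcongr
      _ = _ := by push_cast; ring
  have hd := diam_univ_pos (X := X)
  refine iSup₂_le fun r hr => ?_
  rcases le_total r (2 * Metric.diam (univ : Set X)) with h | h
  · exact main r hr h
  -- Beyond this radius every ball is the whole space and the energy no longer depends on `r`.
  · refine le_trans (le_of_eq ?_) (main (2 * Metric.diam (univ : Set X)) (by positivity) le_rfl)
    simp only [ksEnergyAt]
    simp_rw [ball_eq_univ_of_diam_lt (show Metric.diam (univ : Set X) < r by linarith),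
      ball_eq_univ_of_diam_lt
        (show Metric.diam (univ : Set X) < 2 * Metric.diam (univ : Set X) by linarith)]

/-- Under a Poincaré inequality, the global oscillation with respect to an arbitrary doubling
measure is controlled by the total energy. -/
theorem IsDoubling.exists_lintegral_edist_average_le [ConnectedSpace X] [Nontrivial X]
    (hμ : IsDoubling d μ) (hν : IsDoubling d ν) {p : ℝ} (hp : 1 ≤ p) (C : ℝ≥0) {Λ : ℝ}
    (hΛ : 1 ≤ Λ) :
    ∃ K : ℝ≥0, ∀ (f : C(X, ℝ)) (Γ : Measure X) [IsFiniteMeasure Γ], Poincare μ Γ p C Λ f →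
      ∫⁻ x, edist (f x) (⨍ z, f z ∂μ) ^ p ∂ν ≤ K * Γ univ := by
  have := hν.isFiniteMeasure
  obtain ⟨K, hK⟩ := hμ.exists_deviation_bound hν hp C hΛ
  have hd := diam_univ_pos (X := X)
  refine ⟨(ν univ).toNNReal * K, fun f Γ _ hf => ?_⟩
  -- At this radius the ball is the whole space: the average is the global mean and the weight is
  -- the constant `1 / ν(X)`.
  obtain ⟨G, hGm, hG, hGi⟩ := hK f Γ hf (2 * Metric.diam (univ : Set X)) (by positivity) le_rfl
  simp_rw [ball_eq_univ_of_diam_lt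
    (show Metric.diam (univ : Set X) < 2 * Metric.diam (univ : Set X) by linarith)] at hG hGi
  rw [lintegral_const_mul _ hGm] at hGi
  have hν0 : ν univ ≠ 0 := by
    obtain ⟨x, -⟩ := exists_pair_ne X
    exact ((hν.measure_ball_pos x one_pos).trans_le (measure_mono (subset_univ _))).ne'
  calc _ ≤ ∫⁻ x, G x ∂ν := lintegral_mono fun x => by
        rw [edist_comm]; simpa using hG x
    _ = ν univ * ((ν univ)⁻¹ * ∫⁻ x, G x ∂ν) := by
        rw [← mul_assoc, ENNReal.mul_inv_cancel hν0 (measure_ne_top _ _), one_mul]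
    _ ≤ ν univ * (K * Γ univ) := by gcongr
    _ = _ := by
        rw [ENNReal.coe_mul, ENNReal.coe_toNNReal (measure_ne_top _ _), mul_assoc]

end Poincare
end ConfInv
end

noncomputable section

namespace ConfInv

/-! ### Energy measures on continuous functions -/

/-- A local `p`-homogeneous energy structure on a space of continuous functions. -/
structure ContEnergy (X : Type*) [TopologicalSpace X] [MeasurableSpace X] (p : ℝ) where
  F : Submodule ℝ C(X, ℝ)
  Γ : C(X, ℝ) → Measure X
  finite : ∀ f ∈ F, IsFiniteMeasure (Γ f)
  smul_le : ∀ (c : ℝ), ∀ f ∈ F, ∀ A : Set X,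
    Γ (c • f) A ^ (1 / p) ≤ ENNReal.ofReal |c| * Γ f A ^ (1 / p)
  triangle : ∀ f ∈ F, ∀ g ∈ F, ∀ A : Set X, MeasurableSet A →
    Γ (f + g) A ^ (1 / p) ≤ Γ f A ^ (1 / p) + Γ g A ^ (1 / p)
  contraction : ∀ f ∈ F, ∀ φ : ℝ → ℝ, LipschitzWith 1 φ → φ 0 = 0 → ∀ g : C(X, ℝ),
    (∀ x, g x = φ (f x)) → g ∈ F ∧ ∀ A : Set X, Γ g A ≤ Γ f A
  local_ : ∀ f ∈ F, ∀ (A : Set X) (c : ℝ), IsOpen A → (∀ x ∈ A, f x = c) → Γ f A = 0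
  -- Uniform approximation replaces `L^p`-convergence, so the structure refers to no metric or
  -- reference measure and can be used with `ρ` and `ν`.
  lsc : ∀ (f : C(X, ℝ)) (M : ℝ≥0),
    (∀ ε : ℝ, 0 < ε → ∃ u ∈ F, (∀ x, dist (u x) (f x) ≤ ε) ∧ Γ u univ ≤ M) →
    f ∈ F ∧ Γ f univ ≤ M

namespace ContEnergy

/-! ### Running maxima of families of functions -/

section RunningMax

variable {X : Type*} [TopologicalSpace X]

open Classical in
/-- The maximum of `0` and those of the functions `φ 0, …, φ (k - 1)` whose index satisfies `P`. -/
def runMax (φ : ℕ → C(X, ℝ)) (P : ℕ → Prop) : ℕ → C(X, ℝ)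
  | 0 => 0
  | k + 1 => if P k then runMax φ P k ⊔ φ k else runMax φ P k

theorem runMax_nonneg (φ : ℕ → C(X, ℝ)) (P : ℕ → Prop) (k : ℕ) (z : X) :
    0 ≤ runMax φ P k z := by
  induction k with
  | zero => simp [runMax]
  | succ k ih =>
    rw [runMax]
    split_ifs
    · exact le_sup_of_le_left ih
    · exact ih

/-- The maximum starts from `0`, so functions vanishing at `z` can be dropped there. This localises
the global running maximum. -/
theorem runMax_congr {φ : ℕ → C(X, ℝ)} {P : ℕ → Prop} {k : ℕ} {z : X}
    (h : ∀ j < k, ¬ P j → φ j z = 0) :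
    runMax φ P k z = runMax φ (fun _ => True) k z := by
  induction k with
  | zero => simp [runMax]
  | succ k ih =>
    have ih' := ih fun j hj => h j (by omega)
    rw [runMax, runMax, if_pos trivial]
    split_ifs with hk
    · simp [ih']
    · rw [ih', ContinuousMap.sup_apply, h k (by omega) hk, sup_eq_left.2 (runMax_nonneg _ _ _ _)]

theorem le_runMax {φ : ℕ → C(X, ℝ)} {n k : ℕ} (hk : k < n) (z : X) :
    φ k z ≤ runMax φ (fun _ => True) n z := by
  induction n with
  | zero => omega
  | succ n ih =>
    rw [runMax, if_pos trivial, ContinuousMap.sup_apply]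
    rcases Nat.lt_succ_iff_lt_or_eq.1 hk with h | rfl
    · exact le_sup_of_le_left (ih h)
    · exact le_sup_right

theorem runMax_le_one {φ : ℕ → C(X, ℝ)} {P : ℕ → Prop} {n : ℕ} {z : X}
    (h : ∀ k < n, φ k z ≤ 1) : runMax φ P n z ≤ 1 := by
  induction n with
  | zero => simp [runMax]
  | succ n ih =>
    have := ih fun k hk => h k (by omega)
    rw [runMax]
    split_ifs
    · exact sup_le this (h n (by omega))
    · exact this

end RunningMax

/-! ### Energy of sums, positive parts and maxima -/

section Lattice

variable {X : Type*} [TopologicalSpace X] [MeasurableSpace X] {p : ℝ} (𝓔 : ContEnergy X p)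

/-- The `p`-th root of the energy of a function on a set. -/
def seminorm (f : C(X, ℝ)) (A : Set X) : ℝ≥0∞ := 𝓔.Γ f A ^ (1 / p)

variable {𝓔}

theorem seminorm_zero (A : Set X) : 𝓔.seminorm 0 A = 0 := by
  have := 𝓔.smul_le 0 0 𝓔.F.zero_mem A
  simpa [seminorm] using this

theorem seminorm_sub_le {f g : C(X, ℝ)} (hf : f ∈ 𝓔.F) (hg : g ∈ 𝓔.F) {A : Set X}
    (hA : MeasurableSet A) : 𝓔.seminorm (f - g) A ≤ 𝓔.seminorm f A + 𝓔.seminorm g A := by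
  have h1 := 𝓔.triangle f hf ((-1 : ℝ) • g) (𝓔.F.smul_mem _ hg) A hA
  have h2 := 𝓔.smul_le (-1) g hg A
  rw [show f + (-1 : ℝ) • g = f - g by ext; simp [sub_eq_add_neg]] at h1
  refine h1.trans (add_le_add le_rfl (h2.trans ?_))
  simp [seminorm]

theorem seminorm_sum_le {ι : Type*} (T : Finset ι) (c : ι → ℝ) (ψ : ι → C(X, ℝ))
    (hψ : ∀ k ∈ T, ψ k ∈ 𝓔.F) {A : Set X} (hA : MeasurableSet A) :
    𝓔.seminorm (∑ k ∈ T, c k • ψ k) A ≤ ∑ k ∈ T, ENNReal.ofReal |c k| * 𝓔.seminorm (ψ k) A := by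
  classical
  induction T using Finset.induction_on with
  | empty => simp [seminorm_zero]
  | insert a T ha ih =>
    rw [Finset.sum_insert ha, Finset.sum_insert ha]
    have hT : ∀ k ∈ T, ψ k ∈ 𝓔.F := fun k hk => hψ k (Finset.mem_insert_of_mem hk)
    have haF := hψ a (Finset.mem_insert_self _ _)
    refine (𝓔.triangle _ (𝓔.F.smul_mem _ haF) _
      (𝓔.F.sum_mem fun k hk => 𝓔.F.smul_mem _ (hT k hk)) A hA).trans ?_
    exact add_le_add (𝓔.smul_le _ _ haF A) (ih hT)

theorem sup_zero_mem (hp : 0 < p) {f : C(X, ℝ)} (hf : f ∈ 𝓔.F) :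
    f ⊔ 0 ∈ 𝓔.F ∧ ∀ A, 𝓔.seminorm (f ⊔ 0) A ≤ 𝓔.seminorm f A := by
  obtain ⟨h1, h2⟩ := 𝓔.contraction f hf (fun t => max t 0)
    (by simpa using LipschitzWith.id.max_const (0 : ℝ)) (by simp) (f ⊔ 0) (fun x => by simp)
  exact ⟨h1, fun A => ENNReal.rpow_le_rpow (h2 A) (by positivity)⟩

/-- Write `f ⊔ g = g + (f - g)⁺`. The factor `2` falls on `g` alone, so a running maximum, with `g`
the new member, has energy growing linearly rather than exponentially in the number of members. -/
theorem sup_mem (hp : 0 < p) {f g : C(X, ℝ)} (hf : f ∈ 𝓔.F) (hg : g ∈ 𝓔.F) :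
    f ⊔ g ∈ 𝓔.F ∧ ∀ A, MeasurableSet A →
      𝓔.seminorm (f ⊔ g) A ≤ 𝓔.seminorm f A + 2 * 𝓔.seminorm g A := by
  have e : f ⊔ g = g + (f - g) ⊔ 0 := by
    ext x; simp [add_sup]
  have h1 := sup_zero_mem hp (𝓔.F.sub_mem hf hg)
  rw [e]
  refine ⟨𝓔.F.add_mem hg h1.1, fun A hA => (𝓔.triangle _ hg _ h1.1 A hA).trans ?_⟩
  calc _ ≤ 𝓔.seminorm g A + (𝓔.seminorm f A + 𝓔.seminorm g A) :=
        add_le_add le_rfl ((h1.2 A).trans (seminorm_sub_le hf hg hA))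
    _ = _ := by ring

open Classical in
theorem runMax_mem (hp : 0 < p) {φ : ℕ → C(X, ℝ)} {P : ℕ → Prop} {n : ℕ} {c : ℝ≥0∞}
    (h : ∀ k < n, φ k ∈ 𝓔.F ∧ 𝓔.seminorm (φ k) univ ≤ c) :
    runMax φ P n ∈ 𝓔.F ∧
      𝓔.seminorm (runMax φ P n) univ ≤ 2 * ((Finset.range n).filter P).card * c := by
  induction n with
  | zero => simp [runMax, seminorm_zero]
  | succ n ih =>
    obtain ⟨i1, i2⟩ := ih fun k hk => h k (by omega)
    obtain ⟨j1, j2⟩ := h n (by omega)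
    rw [runMax, Finset.range_add_one, Finset.filter_insert]
    split_ifs with hn
    · obtain ⟨k1, k2⟩ := sup_mem hp i1 j1
      refine ⟨k1, (k2 univ MeasurableSet.univ).trans ?_⟩
      rw [Finset.card_insert_of_notMem (by simp)]
      calc _ ≤ 2 * ((Finset.range n).filter P).card * c + 2 * c := by gcongr
        _ = _ := by push_cast; ring
    · exact ⟨i1, i2⟩

end Lattice

/-! ### Discrete convolution -/

section Discretization

variable {X : Type*} [d : MetricSpace X] [MeasurableSpace X] {p : ℝ}

/-- Existence of cutoff functions with uniformly bounded energy. -/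
def HasCutoffs (𝓔 : ContEnergy X p) (C : ℝ≥0) (Λ : ℝ) : Prop :=
  ∀ (x : X) (r : ℝ), 0 < r → ∃ φ ∈ 𝓔.F, (∀ y, dist y x < r → φ y = 1) ∧
    (∀ y, Λ * r ≤ dist y x → φ y = 0) ∧ (∀ y, 0 ≤ φ y ∧ φ y ≤ 1) ∧
    𝓔.seminorm φ univ ≤ C

open Classical in
/-- A partition of unity made of differences of successive maxima of cutoff functions. -/
theorem HasCutoffs.exists_partition {𝓔 : ContEnergy X p} {C : ℝ≥0} {Λ : ℝ}
    (h : 𝓔.HasCutoffs C Λ) (hp : 0 < p) {n N : ℕ} {x : ℕ → X} {r : ℝ} (hr : 0 < r)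
    (hcover : ∀ z, ∃ k < n, dist z (x k) < r)
    (hN : ∀ k < n, ((Finset.range n).filter fun j => dist (x j) (x k) < 2 * Λ * r).card ≤ N) :
    ∃ ψ : ℕ → C(X, ℝ), (∀ k < n, ψ k ∈ 𝓔.F ∧ 𝓔.seminorm (ψ k) univ ≤ (1 + 2 * N) * C) ∧
      (∀ k z, 0 ≤ ψ k z) ∧ (∀ k z, Λ * r ≤ dist z (x k) → ψ k z = 0) ∧
      ∀ z, ∑ k ∈ Finset.range n, ψ k z = 1 := by
  choose φ hφF hφ1 hφ0 hφI hφE using fun k => h (x k) r hr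
  set P : ℕ → ℕ → Prop := fun k j => dist (x j) (x k) < 2 * Λ * r with hP
  -- Where `φ k` may be nonzero, every `φ j` with `x j` at distance at least `2Λr` from `x k`
  -- vanishes; elsewhere both sides are `0`. So the increment of the global maximum involves only
  -- the boundedly many nearby cutoffs.
  have hpt : ∀ k z, ((φ k - runMax φ (P k) k) ⊔ 0) z =
      runMax φ (fun _ => True) (k + 1) z - runMax φ (fun _ => True) k z := by
    intro k z
    rw [runMax, if_pos trivial]
    simp only [ContinuousMap.sup_apply, ContinuousMap.sub_apply, ContinuousMap.zero_apply]
    by_cases hz : dist z (x k) < Λ * r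
    · rw [runMax_congr (P := P k)]
      · rcases le_total (φ k z) (runMax φ (fun _ => True) k z) with hle | hle
        · rw [sup_eq_right.2 (by linarith), sup_eq_left.2 hle, sub_self]
        · rw [sup_eq_left.2 (by linarith), sup_eq_right.2 hle]
      · intro j _ hj
        apply hφ0
        simp only [hP, not_lt] at hj
        linarith [dist_triangle_left (x j) (x k) z]
    · rw [hφ0 k z (not_lt.1 hz)]
      have h1 := runMax_nonneg φ (P k) k z
      have h2 := runMax_nonneg φ (fun _ => True) k z
      rw [sup_eq_right.2 (by linarith), sup_eq_left.2 h2, sub_self]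
  refine ⟨fun k => (φ k - runMax φ (P k) k) ⊔ 0, fun k hk => ?_, fun k z => ?_, fun k z hz => ?_,
    fun z => ?_⟩
  · obtain ⟨m1, m2⟩ := runMax_mem (𝓔 := 𝓔) (P := P k) (n := k) hp
      fun j _ => ⟨hφF j, hφE j⟩
    obtain ⟨s1, s2⟩ := sup_zero_mem hp (𝓔.F.sub_mem (hφF k) m1)
    refine ⟨s1, (s2 univ).trans ((seminorm_sub_le (hφF k) m1 MeasurableSet.univ).trans ?_)⟩
    rw [add_mul, one_mul]
    refine add_le_add (hφE k) (m2.trans ?_)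
    gcongr
    refine le_trans (Finset.card_le_card ?_) (hN k hk)
    exact Finset.filter_subset_filter _ (Finset.range_subset_range.2 hk.le)
  · exact le_sup_right
  · rw [hpt, runMax, if_pos trivial, ContinuousMap.sup_apply, hφ0 k z hz,
      sup_eq_left.2 (runMax_nonneg _ _ _ _), sub_self]
  · simp_rw [hpt]
    -- The sum telescopes to the full maximum, which is `1` because the balls of radius `r` cover.
    rw [Finset.sum_range_sub (fun k => runMax φ (fun _ => True) k z)]
    obtain ⟨k, hk, hkz⟩ := hcover z
    have h1 := le_runMax (φ := φ) hk z
    rw [hφ1 k z hkz] at h1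
    have h2 := runMax_le_one (φ := φ) (P := fun _ => True) (n := n) (z := z)
      fun k _ => (hφI k z).2
    simp only [runMax, ContinuousMap.zero_apply, sub_zero]
    exact le_antisymm h2 h1

variable [BorelSpace X] {ν : Measure X}

/-- Running maxima need an ordered family, so the finite net is enumerated; values at indices from
`n` on are irrelevant. -/
theorem _root_.ConfInv.IsDoubling.exists_net_seq [CompactSpace X] [Nonempty X] (hν : IsDoubling d ν) {r : ℝ}
    (hr : 0 < r) :
    ∃ (n : ℕ) (x : ℕ → X), (∀ j < n, ∀ k < n, j ≠ k → r ≤ dist (x j) (x k)) ∧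
      ∀ z, ∃ k < n, dist z (x k) < r := by
  obtain ⟨s, hs, hc⟩ := hν.exists_net hr
  let e := s.equivFin
  refine ⟨s.card, fun k => if h : k < s.card then (e.symm ⟨k, h⟩ : X) else Classical.arbitrary X,
    fun j hj k hk hjk => ?_, fun z => ?_⟩
  · simp only [hj, hk, dif_pos]
    refine hs (e.symm _).2 (e.symm _).2 fun h => hjk ?_
    simpa using e.symm.injective (Subtype.ext h)
  · obtain ⟨y, hy, hyz⟩ := hc z
    refine ⟨e ⟨y, hy⟩, (e ⟨y, hy⟩).2, ?_⟩
    simpa using hyz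

theorem _root_.ConfInv.IsDoubling.exists_card_seq_le (hν : IsDoubling d ν) {Λ : ℝ} (hΛ : 0 ≤ Λ) :
    ∃ N : ℕ, ∀ (r : ℝ) (y : X) (n : ℕ) (x : ℕ → X) (T : Finset ℕ), 0 < r →
      (∀ j < n, ∀ k < n, j ≠ k → r ≤ dist (x j) (x k)) →
      (∀ j ∈ T, j < n ∧ dist (x j) y < Λ * r) → T.card ≤ N := by
  classical
  obtain ⟨N, hN⟩ := hν.exists_card_le hΛ
  refine ⟨N, fun r y n x T hr hx hT => ?_⟩
  have hinj : Set.InjOn x T := by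
    intro j hj k hk hjk
    by_contra hne
    have := hx j (hT j hj).1 k (hT k hk).1 hne
    rw [hjk, dist_self] at this
    linarith
  rw [← Finset.card_image_of_injOn hinj]
  refine hN r y _ hr ?_ ?_
  · intro a ha b hb hab
    obtain ⟨j, hj, rfl⟩ := Finset.mem_image.1 (Finset.mem_coe.1 ha)
    obtain ⟨k, hk, rfl⟩ := Finset.mem_image.1 (Finset.mem_coe.1 hb)
    exact hx j (hT j hj).1 k (hT k hk).1 fun h => hab (h ▸ rfl)
  · intro a ha
    obtain ⟨j, hj, rfl⟩ := Finset.mem_image.1 ha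
    exact (hT j hj).2

variable [CompactSpace X]

/-- Comparison of averages of a continuous function over nearby balls. -/
theorem _root_.ConfInv.IsDoubling.exists_edist_average_average_le (hν : IsDoubling d ν)
    (hp : 1 ≤ p) {Λ : ℝ} (hΛ : 1 ≤ Λ) :
    ∃ K : ℝ≥0, ∀ (f : C(X, ℝ)) (x y : X) (r : ℝ), 0 < r → dist y x < 2 * Λ * r →
      edist (⨍ z in Metric.ball y r, f z ∂ν) (⨍ z in Metric.ball x r, f z ∂ν) ^ p ≤
        K * ∫⁻ z in Metric.ball x r, (⨍⁻ w in Metric.ball z (4 * Λ * r),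
          edist (f z) (f w) ^ p / ν (Metric.ball z (4 * Λ * r)) ∂ν) ∂ν := by
  have := hν.isFiniteMeasure
  obtain ⟨K, hK1, hK⟩ := hν.exists_measure_ball_le (4 * Λ)
  refine ⟨K * K, fun f x y r hr hyx => ?_⟩
  have px := (hν.measure_ball_pos x hr).ne'
  have py := (hν.measure_ball_pos y hr).ne'
  rw [edist_comm]
  refine (edist_setAverage_rpow_le hp f _ px).trans ?_
  rw [← lintegral_const_mul' _ _ (ENNReal.inv_ne_top.2 px),
    ← lintegral_const_mul' _ _ ENNReal.coe_ne_top]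
  refine setLIntegral_mono' Metric.isOpen_ball.measurableSet fun z hz => ?_
  have hzx := Metric.mem_ball.1 hz
  have hΛr : r ≤ Λ * r := le_mul_of_one_le_left hr.le hΛ
  have hzy : dist z y ≤ 3 * Λ * r := by
    linarith [dist_triangle z x y, dist_comm x y]
  -- This ball contains `B(y, r)`, and its measure is at most `K` times that of `B(x, r)` and of
  -- `B(y, r)`.
  set w := (ν (Metric.ball z (4 * Λ * r)))⁻¹ with hw
  have hwx : (ν (Metric.ball x r))⁻¹ ≤ K * w :=
    inv_le_mul_inv_of_le_mul hK1 (hK z x r _ hr le_rfl (by linarith))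
  have hwy : (ν (Metric.ball y r))⁻¹ ≤ K * w :=
    inv_le_mul_inv_of_le_mul hK1 (hK z y r _ hr le_rfl (by linarith))
  have hwt : w ≠ ∞ := ENNReal.inv_ne_top.2 (hν.measure_ball_pos z (by positivity)).ne'
  have hsub : Metric.ball y r ⊆ Metric.ball z (4 * Λ * r) :=
    Metric.ball_subset_ball' (by linarith [dist_comm y z])
  rw [edist_comm, setLAverage_eq, ENNReal.div_eq_inv_mul]
  simp_rw [ENNReal.div_eq_inv_mul]
  rw [← hw, lintegral_const_mul' _ _ hwt]
  calc _ ≤ (K * w) * ((K * w) * ∫⁻ v in Metric.ball z (4 * Λ * r), edist (f z) (f v) ^ p ∂ν) := by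
        refine mul_le_mul' hwx ((edist_setAverage_rpow_le hp f _ py).trans (mul_le_mul' hwy ?_))
        simp_rw [edist_comm _ (f z)]
        exact lintegral_mono_set hsub
    _ = _ := by push_cast; ring

theorem _root_.ConfInv.sum_rpow_le_card_rpow_mul {ι : Type*} (hp : 0 < p) (T : Finset ι)
    (b : ι → ℝ≥0∞) : (∑ k ∈ T, b k) ^ p ≤ (T.card : ℝ≥0∞) ^ p * ∑ k ∈ T, b k ^ p := by
  have h : ∀ k ∈ T, b k ≤ (∑ k ∈ T, b k ^ p) ^ (1 / p) := fun k hk => by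
    rw [one_div, ENNReal.le_rpow_inv_iff hp]
    exact Finset.single_le_sum (f := fun k => b k ^ p) (fun _ _ => zero_le) hk
  calc _ ≤ (T.card * (∑ k ∈ T, b k ^ p) ^ (1 / p)) ^ p := by
        gcongr
        refine (Finset.sum_le_sum h).trans_eq ?_
        rw [Finset.sum_const, nsmul_eq_mul]
    _ = _ := by
        rw [ENNReal.mul_rpow_of_nonneg _ _ hp.le, ← ENNReal.rpow_mul,
          one_div_mul_cancel hp.ne', ENNReal.rpow_one]

open Classical in
/-- Integrals over a family of sets with bounded overlap. -/
theorem _root_.ConfInv.sum_setLIntegral_le {ι Y : Type*} [MeasurableSpace Y] {ν : Measure Y}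
    {B : ι → Set Y}
    (hB : ∀ i, MeasurableSet (B i)) (T : Finset ι) {N : ℕ}
    (hN : ∀ z, (T.filter fun i => z ∈ B i).card ≤ N) (g : Y → ℝ≥0∞) :
    ∑ i ∈ T, ∫⁻ z in B i, g z ∂ν ≤ N * ∫⁻ z, g z ∂ν := by
  rw [← lintegral_finsetSum_measure, ← smul_eq_mul, ← lintegral_smul_measure]
  refine lintegral_mono' (Measure.le_iff.2 fun A hA => ?_) le_rfl
  rw [Measure.finsetSum_apply]
  calc _ = ∑ i ∈ T, ∫⁻ z in A, (B i).indicator 1 z ∂ν := by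
        refine Finset.sum_congr rfl fun i _ => ?_
        rw [lintegral_indicator_one (hB i), Measure.restrict_apply hA,
          Measure.restrict_apply (hB i), inter_comm]
    _ = ∫⁻ z in A, ∑ i ∈ T, (B i).indicator 1 z ∂ν := by
        rw [lintegral_finsetSum]
        exact fun i _ => measurable_one.indicator (hB i)
    _ ≤ ∫⁻ z in A, N ∂ν := by
        refine lintegral_mono fun z => ?_
        simp only [indicator_apply, Pi.one_apply, Finset.sum_boole]
        exact_mod_cast hN z
    _ = _ := by simp

open Classical in
/-- Discrete convolution: a continuous function is approximated by functions whose energy is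
controlled by the Korevaar–Schoen energy at the corresponding scale. -/
theorem HasCutoffs.exists_approximation [Nonempty X] {𝓔 : ContEnergy X p} {C : ℝ≥0} {Λ : ℝ}
    (h : 𝓔.HasCutoffs C Λ) (hp : 1 ≤ p) (hΛ : 1 ≤ Λ) (hν : IsDoubling d ν) :
    ∃ K : ℝ≥0, ∀ (f : C(X, ℝ)) (r : ℝ), 0 < r → ∃ u ∈ 𝓔.F,
      (∀ ε, (∀ y z, dist y z < 2 * Λ * r → dist (f y) (f z) ≤ ε) → ∀ z, dist (u z) (f z) ≤ ε) ∧
      𝓔.Γ u univ ≤ K * ksEnergyAt p ν f (4 * Λ * r) := by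
  have := hν.isFiniteMeasure
  have hp0 : 0 < p := by linarith
  obtain ⟨N, hN⟩ := hν.exists_card_seq_le (Λ := 2 * Λ) (by positivity)
  obtain ⟨K, hK⟩ := hν.exists_edist_average_average_le hp hΛ
  set c : ℝ≥0 := (1 + 2 * N) * C with hc
  refine ⟨(c * N) ^ p * (N * (K * N)), fun f r hr => ?_⟩
  obtain ⟨n, x, hsep, hcover⟩ := hν.exists_net_seq hr
  have hΛr : r ≤ Λ * r := le_mul_of_one_le_left hr.le hΛ
  obtain ⟨ψ, hψ, hψ0, hψs, hψ1⟩ := h.exists_partition hp0 hr hcover (N := N) fun k _ =>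
    hN r (x k) n x _ hr hsep fun j hj => by simpa using hj
  set a : ℕ → ℝ := fun k => ⨍ z in Metric.ball (x k) r, f z ∂ν with ha
  have hF : ∀ (T : Finset ℕ) (b : ℕ → ℝ), T ⊆ Finset.range n → ∑ k ∈ T, b k • ψ k ∈ 𝓔.F :=
    fun T b hT => 𝓔.F.sum_mem fun k hk =>
      𝓔.F.smul_mem _ (hψ k (Finset.mem_range.1 (hT hk))).1
  set u : C(X, ℝ) := ∑ k ∈ Finset.range n, a k • ψ k with hu
  have huz : ∀ z, u z = ∑ k ∈ Finset.range n, a k * ψ k z := fun z => by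
    simp [hu, ContinuousMap.sum_apply]
  -- Used with `t = f z` for the approximation and with `t = a i` for the energy on the `i`-th ball.
  have hsub : ∀ (z : X) (t : ℝ), u z - t = ∑ k ∈ Finset.range n, (a k - t) * ψ k z := by
    intro z t
    simp_rw [sub_mul]
    rw [Finset.sum_sub_distrib, ← huz, ← Finset.mul_sum, hψ1, mul_one]
  refine ⟨u, hF _ a subset_rfl, fun ε hε z => ?_, ?_⟩
  · rw [Real.dist_eq, hsub]
    calc _ ≤ ∑ k ∈ Finset.range n, |(a k - f z) * ψ k z| := Finset.abs_sum_le_sum_abs _ _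
      _ ≤ ∑ k ∈ Finset.range n, ε * ψ k z := by
          refine Finset.sum_le_sum fun k _ => ?_
          rw [abs_mul, abs_of_nonneg (hψ0 k z)]
          rcases le_or_gt (Λ * r) (dist z (x k)) with hk | hk
          · simp [hψs k z hk]
          · refine mul_le_mul_of_nonneg_right ?_ (hψ0 k z)
            rw [← Real.dist_eq]
            refine dist_setAverage_le f (f z) ε Metric.isOpen_ball.measurableSet
              (hν.measure_ball_pos _ hr).ne' fun y hy => hε y z ?_
            linarith [dist_triangle y (x k) z, Metric.mem_ball.1 hy, dist_comm z (x k)]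
      _ = ε := by rw [← Finset.mul_sum, hψ1, mul_one]
  set I : X → ℝ≥0∞ := fun z => ⨍⁻ w in Metric.ball z (4 * Λ * r),
    edist (f z) (f w) ^ p / ν (Metric.ball z (4 * Λ * r)) ∂ν with hI
  set T : ℕ → Finset ℕ := fun i =>
    (Finset.range n).filter fun k => dist (x k) (x i) < 2 * Λ * r with hT
  have hTcard : ∀ i, (T i).card ≤ N := fun i =>
    hN r (x i) n x _ hr hsep fun j hj => by simpa [hT] using hj
  have hball : ∀ i, 𝓔.Γ u (Metric.ball (x i) r) ≤
      (c * N) ^ p * (N * (K * ∫⁻ z in Metric.ball (x i) r, I z ∂ν)) := by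
    intro i
    have hBm : MeasurableSet (Metric.ball (x i) r) := Metric.isOpen_ball.measurableSet
    set g : C(X, ℝ) := ∑ k ∈ T i, (a k - a i) • ψ k with hg
    have hTn : T i ⊆ Finset.range n := Finset.filter_subset _ _
    have hgF : g ∈ 𝓔.F := hF _ (fun k => a k - a i) hTn
    have huF : u ∈ 𝓔.F := hF _ a subset_rfl
    -- On this ball the `ψ k` with `k ∉ T i` vanish, so `u - g` equals `a i` there and locality
    -- applies.
    have hconst : 𝓔.Γ (u - g) (Metric.ball (x i) r) = 0 := by
      refine 𝓔.local_ _ (𝓔.F.sub_mem huF hgF) _ (a i) Metric.isOpen_ball fun z hz => ?_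
      have h1 : g z = ∑ k ∈ Finset.range n, (a k - a i) * ψ k z := by
        rw [hg]
        simp only [ContinuousMap.sum_apply, ContinuousMap.smul_apply, smul_eq_mul]
        refine Finset.sum_subset hTn fun k hk hkT => ?_
        have hki : 2 * Λ * r ≤ dist (x k) (x i) := by
          by_contra! hlt
          exact hkT (Finset.mem_filter.2 ⟨hk, hlt⟩)
        rw [hψs k z, mul_zero]
        linarith [dist_triangle_left (x k) (x i) z, Metric.mem_ball.1 hz]
      rw [ContinuousMap.sub_apply, h1, ← hsub]
      ring
    have h2 : 𝓔.seminorm u (Metric.ball (x i) r) ≤ c * ∑ k ∈ T i, edist (a k) (a i) := by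
      calc 𝓔.seminorm u (Metric.ball (x i) r)
          = 𝓔.seminorm (g + (u - g)) (Metric.ball (x i) r) := by rw [add_sub_cancel]
        _ ≤ 𝓔.seminorm g (Metric.ball (x i) r) + 𝓔.seminorm (u - g) (Metric.ball (x i) r) :=
            𝓔.triangle _ hgF _ (𝓔.F.sub_mem huF hgF) _ hBm
        _ = 𝓔.seminorm g (Metric.ball (x i) r) := by
            rw [show 𝓔.seminorm (u - g) (Metric.ball (x i) r) = 0 by
              rw [seminorm, hconst, ENNReal.zero_rpow_of_pos (by positivity)], add_zero]
        _ ≤ ∑ k ∈ T i, ENNReal.ofReal |a k - a i| * 𝓔.seminorm (ψ k) (Metric.ball (x i) r) :=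
            seminorm_sum_le _ _ _ (fun k hk => (hψ k (Finset.mem_range.1 (hTn hk))).1) hBm
        _ ≤ ∑ k ∈ T i, edist (a k) (a i) * c := by
            refine Finset.sum_le_sum fun k hk => ?_
            rw [edist_dist, Real.dist_eq]
            gcongr
            refine le_trans ?_ ((hψ k (Finset.mem_range.1 (hTn hk))).2.trans_eq ?_)
            · exact ENNReal.rpow_le_rpow (measure_mono (subset_univ _)) (by positivity)
            · rw [hc]; push_cast; rfl
        _ = _ := by rw [← Finset.sum_mul, mul_comm]
    have h3 : 𝓔.Γ u (Metric.ball (x i) r) = 𝓔.seminorm u (Metric.ball (x i) r) ^ p := by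
      rw [seminorm, ← ENNReal.rpow_mul, one_div_mul_cancel hp0.ne', ENNReal.rpow_one]
    rw [h3]
    calc _ ≤ (c * ∑ k ∈ T i, edist (a k) (a i)) ^ p := by gcongr
      _ ≤ (c : ℝ≥0∞) ^ p * ((T i).card ^ p * ∑ k ∈ T i, edist (a k) (a i) ^ p) := by
          rw [ENNReal.mul_rpow_of_nonneg _ _ hp0.le]
          gcongr
          exact sum_rpow_le_card_rpow_mul hp0 _ _
      _ ≤ (c : ℝ≥0∞) ^ p * (N ^ p *
            ∑ k ∈ T i, (K * ∫⁻ z in Metric.ball (x i) r, I z ∂ν)) := by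
          gcongr with k hk
          · exact hTcard i
          · exact hK f (x i) (x k) r hr (Finset.mem_filter.1 hk).2
      _ = (c * N) ^ p * ((T i).card * (K * ∫⁻ z in Metric.ball (x i) r, I z ∂ν)) := by
          rw [Finset.sum_const, nsmul_eq_mul, ENNReal.mul_rpow_of_nonneg _ _ hp0.le, mul_assoc]
      _ ≤ _ := by
          gcongr
          exact hTcard i
  calc 𝓔.Γ u univ ≤ 𝓔.Γ u (⋃ i ∈ Finset.range n, Metric.ball (x i) r) := by
        refine measure_mono fun z _ => ?_
        obtain ⟨k, hk, hkz⟩ := hcover z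
        simp only [mem_iUnion]
        exact ⟨k, Finset.mem_range.2 hk, hkz⟩
    _ ≤ ∑ i ∈ Finset.range n, 𝓔.Γ u (Metric.ball (x i) r) := measure_biUnion_finset_le _ _
    _ ≤ ∑ i ∈ Finset.range n,
          (c * N) ^ p * (N * (K * ∫⁻ z in Metric.ball (x i) r, I z ∂ν)) :=
        Finset.sum_le_sum fun i _ => hball i
    _ = (c * N) ^ p * (N * (K * ∑ i ∈ Finset.range n, ∫⁻ z in Metric.ball (x i) r, I z ∂ν)) := by
        simp_rw [Finset.mul_sum]
    _ ≤ (c * N) ^ p * (N * (K * (N * ∫⁻ z, I z ∂ν))) := by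
        gcongr
        refine sum_setLIntegral_le (fun i => Metric.isOpen_ball.measurableSet) _ (fun z => ?_) I
        refine hN r z n x _ hr hsep fun j hj => ?_
        obtain ⟨hj1, hj2⟩ := Finset.mem_filter.1 hj
        refine ⟨Finset.mem_range.1 hj1, ?_⟩
        linarith [Metric.mem_ball'.1 hj2]
    _ = _ := by
        rw [show ksEnergyAt p ν f (4 * Λ * r) = ∫⁻ z, I z ∂ν from rfl]
        push_cast
        rw [ENNReal.coe_rpow_of_nonneg _ hp0.le]
        push_cast
        ring

/-- A continuous function with finite Korevaar–Schoen energy belongs to the domain of every energy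
with cutoff functions of uniformly bounded energy. -/
theorem HasCutoffs.exists_energy_le [Nonempty X] {𝓔 : ContEnergy X p} {C : ℝ≥0} {Λ : ℝ}
    (h : 𝓔.HasCutoffs C Λ) (hp : 1 ≤ p) (hΛ : 1 ≤ Λ) (hν : IsDoubling d ν) :
    ∃ K : ℝ≥0, ∀ f : C(X, ℝ), ksEnergy p ν f < ∞ →
      f ∈ 𝓔.F ∧ 𝓔.Γ f univ ≤ K * ksEnergy p ν f := by
  obtain ⟨K, hK⟩ := h.exists_approximation hp hΛ hν
  refine ⟨K, fun f hf => ?_⟩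
  lift ksEnergy p ν f to ℝ≥0 using hf.ne with M hM
  rw [← ENNReal.coe_mul]
  refine 𝓔.lsc f (K * M) fun ε hε => ?_
  obtain ⟨δ, hδ, hfδ⟩ := Metric.uniformContinuous_iff.1
    (CompactSpace.uniformContinuous_of_continuous f.continuous) ε hε
  -- The scale makes `2Λr` equal to the modulus of continuity `δ` for `ε`.
  have hr : 0 < δ / (2 * Λ) := by positivity
  obtain ⟨u, huF, hu, huE⟩ := hK f (δ / (2 * Λ)) hr
  refine ⟨u, huF, hu ε fun y z hyz => (hfδ ?_).le, huE.trans ?_⟩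
  · rwa [mul_div_cancel₀ _ (by positivity)] at hyz
  · rw [ENNReal.coe_mul, hM]
    gcongr
    exact le_iSup₂ (f := fun r (_ : 0 < r) => ksEnergyAt p ν f r) _ (by positivity)

end Discretization

end ContEnergy
end ConfInv
end

noncomputable section

namespace ConfInv

/-! ### The energy structure of a Dirichlet space -/

section OfDirichlet

theorem memLp_continuousMap {X : Type*} [TopologicalSpace X] [CompactSpace X] [MeasurableSpace X]
    [BorelSpace X] (μ : Measure X) [IsFiniteMeasure μ] (q : ℝ≥0∞) (f : C(X, ℝ)) :
    MemLp f q μ :=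
  f.continuous.memLp_of_hasCompactSupport (HasCompactSupport.of_compactSpace f)

variable {X : Type*} [d : MetricSpace X] [MeasurableSpace X] [BorelSpace X]
  {p : ℝ} {μ : Measure X} (D : DirichletSpace p μ)

namespace DirichletSpace

/-- The continuous functions in the domain of the Dirichlet space. -/
def contDomain : Submodule ℝ C(X, ℝ) where
  carrier := {f | ∃ u : D.F, f =ᵐ[μ] (u : Lp ℝ (ENNReal.ofReal p) μ)}
  zero_mem' := ⟨0, (Lp.coeFn_zero _ _ _).symm⟩
  add_mem' := by
    rintro f g ⟨u, hu⟩ ⟨v, hv⟩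
    exact ⟨u + v, (hu.add hv).trans (Lp.coeFn_add _ _).symm⟩
  smul_mem' := by
    rintro c f ⟨u, hu⟩
    exact ⟨c • u, (hu.const_smul c).trans (Lp.coeFn_smul _ _).symm⟩

open Classical in
/-- The energy measure of a continuous function in the domain. -/
def contΓ (f : C(X, ℝ)) : Measure X :=
  if h : ∃ u : D.F, f =ᵐ[μ] (u : Lp ℝ (ENNReal.ofReal p) μ) then D.Γ h.choose else 0

variable {D}

/-- The `L^p`-class of `f` is unique, so the choice in the definition is harmless. -/
theorem contΓ_eq {f : C(X, ℝ)} {u : D.F} (h : f =ᵐ[μ] (u : Lp ℝ (ENNReal.ofReal p) μ)) :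
    D.contΓ f = D.Γ u := by
  have hex : ∃ u : D.F, f =ᵐ[μ] (u : Lp ℝ (ENNReal.ofReal p) μ) := ⟨u, h⟩
  rw [contΓ, dif_pos hex]
  congr 1
  exact Subtype.ext (Lp.ext (hex.choose_spec.symm.trans h))

variable (D)

/-- The energy structure on continuous functions induced by a Dirichlet space. -/
def contEnergy [CompactSpace X] [IsFiniteMeasure μ] : ContEnergy X p where
  F := D.contDomain
  Γ := D.contΓ
  finite := by
    rintro f ⟨u, hu⟩
    rw [contΓ_eq hu]
    exact ⟨by rw [D.mass]; exact ENNReal.coe_lt_top⟩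
  smul_le := by
    rintro c f ⟨u, hu⟩ A
    have hp := D.one_lt
    have h : (c • f : C(X, ℝ)) =ᵐ[μ] ((c • u : D.F) : Lp ℝ (ENNReal.ofReal p) μ) :=
      (hu.const_smul c).trans (Lp.coeFn_smul _ _).symm
    rw [contΓ_eq h, contΓ_eq hu, D.homogeneous, Measure.smul_apply, smul_eq_mul,
      ENNReal.mul_rpow_of_nonneg _ _ (by positivity),
      ← ENNReal.ofReal_rpow_of_nonneg (abs_nonneg c) (by linarith), ← ENNReal.rpow_mul,
      mul_one_div_cancel (by linarith), ENNReal.rpow_one]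
  triangle := by
    rintro f ⟨u, hu⟩ g ⟨v, hv⟩ A hA
    have h : (f + g : C(X, ℝ)) =ᵐ[μ] ((u + v : D.F) : Lp ℝ (ENNReal.ofReal p) μ) :=
      (hu.add hv).trans (Lp.coeFn_add _ _).symm
    rw [contΓ_eq h, contΓ_eq hu, contΓ_eq hv]
    exact D.triangle u v A hA
  contraction := by
    rintro f ⟨u, hu⟩ φ hφ h0 g hg
    obtain ⟨h1, h2⟩ := D.contraction u φ hφ h0
    have h : g =ᵐ[μ] ((⟨_, h1⟩ : D.F) : Lp ℝ (ENNReal.ofReal p) μ) := by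
      filter_upwards [hu, hφ.coeFn_compLp h0 (u : Lp ℝ (ENNReal.ofReal p) μ)] with x hx hx'
      rw [hx', hg, hx]; rfl
    refine ⟨⟨_, h⟩, fun A => ?_⟩
    rw [contΓ_eq h, contΓ_eq hu]
    exact h2 A
  local_ := by
    rintro f ⟨u, hu⟩ A c hA hc
    rw [contΓ_eq hu]
    refine D.local_ u A c hA ?_
    filter_upwards [hu] with x hx hxA
    rw [← hx, hc x hxA]
  lsc := by
    intro f M h
    have hp := D.one_lt
    have hε : ∀ n : ℕ, (0 : ℝ) < 1 / ((n : ℝ) + 1) := fun n => by positivity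
    choose g hgF hgd hgM using fun n : ℕ => h _ (hε n)
    choose u hu using hgF
    set v : Lp ℝ (ENNReal.ofReal p) μ := (memLp_continuousMap μ _ f).toLp f with hv
    have hfv : f =ᵐ[μ] v := (MemLp.coeFn_toLp _).symm
    have hE : ∀ n, D.E (u n) ≤ M := fun n => by
      have := hgM n
      rw [contΓ_eq (hu n), D.mass] at this
      exact_mod_cast this
    -- Uniform convergence implies `L^p`-convergence because `μ` is finite.
    have hlim : Tendsto (fun i => ‖(u i : Lp ℝ (ENNReal.ofReal p) μ) - v‖) atTop (𝓝 0) := by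
      set c : ℝ := ((measureUnivNNReal μ ^ (ENNReal.ofReal p).toReal⁻¹ : ℝ≥0) : ℝ) with hc
      have hlim₀ : Tendsto (fun n : ℕ => c * (1 / ((n : ℝ) + 1))) atTop (𝓝 0) := by
        simpa using tendsto_one_div_add_atTop_nhds_zero_nat.const_mul c
      refine squeeze_zero (fun _ => ENNReal.toReal_nonneg) (fun n => ?_) hlim₀
      refine (Lp.norm_le_of_ae_bound (hε n).le ?_).trans_eq ?_
      · filter_upwards [hu n, hfv, Lp.coeFn_sub (u n : Lp ℝ (ENNReal.ofReal p) μ) v] with x h1 h2 h3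
        rw [h3, Pi.sub_apply, ← h1, ← h2, ← dist_eq_norm]
        exact hgd n x
      · rw [hc]; push_cast; rfl
    obtain ⟨h1, h2⟩ := D.lsc v u hlim ⟨M, by rintro _ ⟨n, rfl⟩; exact hE n⟩
    have h : f =ᵐ[μ] ((⟨v, h1⟩ : D.F) : Lp ℝ (ENNReal.ofReal p) μ) := hfv
    refine ⟨⟨_, h⟩, ?_⟩
    rw [contΓ_eq h]
    refine (h2 univ MeasurableSet.univ).trans ?_
    refine liminf_le_of_frequently_le' (Frequently.of_forall fun n => ?_)
    rw [D.mass]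
    exact_mod_cast hE n

end DirichletSpace

theorem ofReal_abs_sub_rpow {p : ℝ} (hp : 0 ≤ p) (a b : ℝ) :
    ENNReal.ofReal (|a - b| ^ p) = edist a b ^ p := by
  rw [edist_dist, Real.dist_eq, ENNReal.ofReal_rpow_of_nonneg (abs_nonneg _) hp]

theorem ofReal_le_two_mul_ediam {X : Type*} [MetricSpace X] {r : ℝ}
    (hr : r ≤ 2 * Metric.diam (univ : Set X)) :
    ENNReal.ofReal r ≤ 2 * Metric.ediam (univ : Set X) := by
  refine (ENNReal.ofReal_le_ofReal hr).trans ?_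
  rw [ENNReal.ofReal_mul (by norm_num), Metric.diam]
  simpa using mul_le_mul' (le_refl (2 : ℝ≥0∞)) ENNReal.ofReal_toReal_le

variable {D}

/-- Only the existence of the curves matters here, not their diameter. -/
theorem StandingAssumption.connectedSpace [Nonempty X] {β dH : ℝ}
    (hD : StandingAssumption D β dH) : ConnectedSpace X := by
  obtain ⟨K, -, hK⟩ := hD.boundedTurning
  refine { isPreconnected_univ := isPreconnected_of_forall_pair fun x _ y _ => ?_,
           toNonempty := inferInstance }
  obtain ⟨γ, hx, hy, -⟩ := hK x y
  exact ⟨range γ, subset_univ _, hx, hy, isPreconnected_range γ.continuous⟩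

/-- A Hausdorff measure of positive dimension gives no mass to a point, whereas balls have positive
mass. -/
theorem StandingAssumption.nontrivial [Nonempty X] {β dH : ℝ}
    (hD : StandingAssumption D β dH) : Nontrivial X := by
  by_contra h
  rw [not_nontrivial_iff_subsingleton] at h
  obtain ⟨x⟩ := ‹Nonempty X›
  have h1 := hD.poincareDirichlet.doubling.measure_ball_pos x one_pos
  have := Measure.nullSingletonClass_hausdorff X hD.dH_pos
  have h2 : μ (Metric.ball x 1) = 0 := by
    rw [hD.measure_eq]
    exact (Set.subsingleton_of_subsingleton).measure_zero _
  exact h1.ne' h2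

/-- The conformally invariant form of the Poincaré inequality. -/
theorem StandingAssumption.exists_poincare {β : ℝ} (hD : StandingAssumption D β β) :
    ∃ (C : ℝ≥0) (σ : ℝ), 1 ≤ σ ∧ ∀ (f : C(X, ℝ)) (u : D.F),
      f =ᵐ[μ] (u : Lp ℝ (ENNReal.ofReal p) μ) → ∀ (x : X) (r : ℝ), 0 < r →
      r ≤ 2 * Metric.diam (univ : Set X) → ∃ c : ℝ,
      ∫⁻ y in Metric.ball x r, edist (f y) c ^ p ∂μ ≤
        C * μ (Metric.ball x r) * D.Γ u (Metric.ball x (σ * r)) := by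
  obtain ⟨C, σ, hC, hσ, h⟩ := hD.poincareDirichlet.poincare
  obtain ⟨A, hA, hreg⟩ := hD.ahlfors
  have hp := D.one_lt
  refine ⟨(C * A).toNNReal, σ, hσ, fun f u hfu x r hr hrd =>
    ⟨⨍ z in Metric.ball x r, (u : Lp ℝ (ENNReal.ofReal p) μ) z ∂μ, ?_⟩⟩
  have h1 := h x r hr u
  simp_rw [ofReal_abs_sub_rpow (show 0 ≤ p by linarith)] at h1
  have h2 := (hreg x r hr (ofReal_le_two_mul_ediam hrd)).1
  rw [← hD.measure_eq] at h2
  have e : ∫⁻ y in Metric.ball x r, edist (f y)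
      (⨍ z in Metric.ball x r, (u : Lp ℝ (ENNReal.ofReal p) μ) z ∂μ) ^ p ∂μ =
      ∫⁻ y in Metric.ball x r, edist ((u : Lp ℝ (ENNReal.ofReal p) μ) y)
      (⨍ z in Metric.ball x r, (u : Lp ℝ (ENNReal.ofReal p) μ) z ∂μ) ^ p ∂μ := by
    refine lintegral_congr_ae (ae_restrict_of_ae ?_)
    filter_upwards [hfu] with y hy
    rw [hy]
  rw [e]
  refine h1.trans (mul_le_mul' ?_ le_rfl)
  -- The lower Ahlfors bound replaces `r ^ β` by `μ (B(x, r))`; this uses that the dimension equals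
  -- `β`.
  calc ENNReal.ofReal (C * r ^ β) = ENNReal.ofReal (C * A) * ENNReal.ofReal (A⁻¹ * r ^ β) := by
        rw [← ENNReal.ofReal_mul (by positivity)]
        congr 1
        field_simp
    _ ≤ _ := by
        change ENNReal.ofReal (C * A) * _ ≤ ENNReal.ofReal (C * A) * _
        gcongr

/-- Cutoff functions with uniformly bounded energy. -/
theorem StandingAssumption.exists_cutoff [CompactSpace X] [IsFiniteMeasure μ] {β : ℝ}
    (hD : StandingAssumption D β β) :
    ∃ C : ℝ≥0, ∀ (x : X) (r : ℝ), 0 < r → r ≤ 2 * Metric.diam (univ : Set X) →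
      ∃ φ ∈ D.contEnergy.F, (∀ y ∈ Metric.ball x r, φ y = 1) ∧
        (∀ y ∉ Metric.ball x (2 * r), φ y = 0) ∧ (∀ y, 0 ≤ φ y ∧ φ y ≤ 1) ∧
        D.contEnergy.seminorm φ univ ≤ C := by
  obtain ⟨C, hC, h⟩ := hD.poincareDirichlet.capacity
  obtain ⟨A, hA, hreg⟩ := hD.ahlfors
  have hp := D.one_lt
  refine ⟨(C * A).toNNReal ^ (1 / p), fun x r hr hrd => ?_⟩
  obtain ⟨φ, u, hφu, hφ1, hφ0, hE⟩ := h x r hr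
  have hφF : φ ∈ D.contEnergy.F := ⟨u, hφu⟩
  have h2 := (hreg x r hr (ofReal_le_two_mul_ediam hrd)).2
  rw [← hD.measure_eq] at h2
  -- Truncation to `[0, 1]` is `1`-Lipschitz and fixes `0`, so it does not increase the energy.
  let g : C(X, ℝ) := ⟨fun y => max 0 (min (φ y) 1), by fun_prop⟩
  obtain ⟨hgF, hgΓ⟩ := D.contEnergy.contraction φ hφF (fun t => max 0 (min t 1))
    ((LipschitzWith.id.min_const (1 : ℝ)).const_max (0 : ℝ)) (by simp) g (fun y => rfl)
  refine ⟨g, hgF, fun y hy => ?_, fun y hy => ?_, fun y => ⟨le_max_left _ _, ?_⟩, ?_⟩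
  · change max 0 (min (φ y) 1) = 1
    rw [hφ1 y hy]; simp
  · change max 0 (min (φ y) 1) = 0
    rw [hφ0 y hy]; simp
  · exact max_le (by norm_num) (min_le_right _ _)
  · rw [ENNReal.coe_rpow_of_nonneg _ (by positivity)]
    refine ENNReal.rpow_le_rpow ((hgΓ univ).trans ?_) (by positivity)
    rw [show D.contEnergy.Γ φ = D.Γ u from DirichletSpace.contΓ_eq hφu, D.mass]
    refine hE.trans ?_
    have hrβ : 0 < r ^ β := Real.rpow_pos_of_pos hr β
    calc _ ≤ ENNReal.ofReal C * (ENNReal.ofReal (A * r ^ β) / ENNReal.ofReal (r ^ β)) := by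
          gcongr
      _ = ENNReal.ofReal (C * A) := by
          rw [← ENNReal.ofReal_div_of_pos hrβ, mul_div_cancel_right₀ _ hrβ.ne',
            ENNReal.ofReal_mul (by linarith)]

end OfDirichlet

/-! ### Quasisymmetric changes of metric -/

section Quasisymmetry

/-- The two consequences of quasisymmetry used below, for a distance function `δ`. -/
structure DistortionControl {X : Type*} [MetricSpace X] (δ : X → X → ℝ) : Prop where
  upper : ∀ M : ℝ, ∃ B : ℝ, 1 ≤ B ∧ ∀ x y z : X, x ≠ z →
    dist x y ≤ M * dist x z → δ x y ≤ B * δ x z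
  small : ∀ ε : ℝ, 0 < ε → ∃ t : ℝ, 0 < t ∧ ∀ x y z : X, x ≠ z →
    dist x y ≤ t * dist x z → δ x y < ε * δ x z

/-- A continuous injection is strictly monotone, and a decreasing one would be bounded by its value
at `0`, against surjectivity. -/
theorem homeomorph_nnreal_apply_zero (η : ℝ≥0 ≃ₜ ℝ≥0) : η 0 = 0 := by
  rcases η.continuous.strictMono_of_inj η.injective with h | h
  · refine le_antisymm ?_ zero_le
    obtain ⟨t, ht⟩ := η.surjective 0
    exact (h.monotone (zero_le (a := t))).trans_eq ht
  · obtain ⟨t, ht⟩ := η.surjective (η 0 + 1)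
    have := h.antitone (zero_le (a := t))
    rw [ht] at this
    exact absurd this (not_le.2 (lt_add_one _))

/-- `upper` is boundedness of `η` on a compact interval; `small` is continuity of `η` at `0` with `η
0 = 0`. -/
theorem Quasisymmetric.distortionControl {X : Type*} {ρ : MetricSpace X} [d : MetricSpace X]
    (h : Quasisymmetric ρ d) :
    DistortionControl fun x y => ρ.toPseudoMetricSpace.toDist.dist x y := by
  obtain ⟨η, hη⟩ := h
  have key : ∀ x y z : X, x ≠ z → ∀ (M : ℝ) (B : ℝ≥0), dist x y ≤ M * dist x z →
      (∀ t : ℝ≥0, (t : ℝ) ≤ M → η t ≤ B) →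
      ρ.toPseudoMetricSpace.toDist.dist x y ≤ B * ρ.toPseudoMetricSpace.toDist.dist x z := by
    intro x y z hxz M B hM hB
    have hd : 0 < dist x z := dist_pos.2 hxz
    have hρ : 0 < ρ.toPseudoMetricSpace.toDist.dist x z := (@dist_pos X ρ x z).2 hxz
    have h1 := (hη x y z hxz).trans (hB _ (by
      rw [NNReal.coe_div, coe_nndist, coe_nndist, div_le_iff₀ hd]; exact hM))
    have h2 : (ρ.toPseudoMetricSpace.toDist.dist x y) /
        (ρ.toPseudoMetricSpace.toDist.dist x z) ≤ B := by exact_mod_cast h1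
    rwa [div_le_iff₀ hρ] at h2
  constructor
  · intro M
    obtain ⟨B, hB⟩ := (isCompact_Icc (a := (0 : ℝ≥0)) (b := M.toNNReal)).bddAbove_image
      η.continuous.continuousOn
    refine ⟨max B 1, le_max_right _ _, fun x y z hxz hM => ?_⟩
    have := key x y z hxz M (max B 1) hM fun t ht => le_max_of_le_left
      (hB ⟨t, ⟨zero_le, NNReal.le_toNNReal_of_coe_le ht⟩, rfl⟩)
    simpa using this
  · intro ε hε
    have h0 : Tendsto η (𝓝 0) (𝓝 0) := by
      have := η.continuous.tendsto 0
      rwa [homeomorph_nnreal_apply_zero] at this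
    have hε2 : 0 < (ε / 2).toNNReal := by simpa using hε
    obtain ⟨t, ht, hη0⟩ := Metric.eventually_nhds_iff.1 (h0.eventually (gt_mem_nhds hε2))
    refine ⟨t / 2, by positivity, fun x y z hxz hM => ?_⟩
    have := key x y z hxz (t / 2) (ε / 2).toNNReal hM fun q hq => (hη0 (by
      rw [NNReal.dist_eq]; simp; linarith)).le
    rw [Real.coe_toNNReal _ (by positivity)] at this
    have hρ : 0 < ρ.toPseudoMetricSpace.toDist.dist x z := (@dist_pos X ρ x z).2 hxz
    exact this.trans_lt (by nlinarith)

theorem t2Space_of_metricSpace {X : Type*} (ρ : MetricSpace X) :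
    @T2Space X ρ.toPseudoMetricSpace.toUniformSpace.toTopologicalSpace :=
  inferInstance

/-- Control at small ratios makes the identity from `d` to `ρ` continuous; compactness gives the
inverse, so quasisymmetry need not be inverted. -/
theorem Quasisymmetric.topology_eq {X : Type*} {ρ : MetricSpace X} [d : MetricSpace X]
    [CompactSpace X] (h : Quasisymmetric ρ d) :
    d.toPseudoMetricSpace.toUniformSpace.toTopologicalSpace =
      ρ.toPseudoMetricSpace.toUniformSpace.toTopologicalSpace := by
  have hc : @Continuous X X d.toPseudoMetricSpace.toUniformSpace.toTopologicalSpace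
      ρ.toPseudoMetricSpace.toUniformSpace.toTopologicalSpace id := by
    rw [@Metric.continuous_iff X X d.toPseudoMetricSpace ρ.toPseudoMetricSpace]
    intro x ε hε
    by_cases hx : ∃ z, x ≠ z
    · obtain ⟨z, hz⟩ := hx
      have hd : 0 < dist x z := dist_pos.2 hz
      have hρ : 0 < ρ.toPseudoMetricSpace.toDist.dist x z := (@dist_pos X ρ x z).2 hz
      obtain ⟨t, ht, htz⟩ := h.distortionControl.small
        (ε / ρ.toPseudoMetricSpace.toDist.dist x z) (by positivity)
      refine ⟨t * dist x z, by positivity, fun y hy => ?_⟩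
      have := htz x y z hz (by rw [dist_comm]; exact hy.le)
      rw [div_mul_cancel₀ _ hρ.ne'] at this
      rw [ρ.toPseudoMetricSpace.dist_comm] at this
      exact this
    · push Not at hx
      refine ⟨1, one_pos, fun y _ => ?_⟩
      rw [← hx y]
      simpa [@dist_self X ρ.toPseudoMetricSpace] using hε
  refine le_antisymm (continuous_id_iff_le.1 hc) (continuous_id_iff_le.1 ?_)
  exact @Continuous.continuous_symm_of_equiv_compact_to_t2 X X
    d.toPseudoMetricSpace.toUniformSpace.toTopologicalSpace
    ρ.toPseudoMetricSpace.toUniformSpace.toTopologicalSpace _ (t2Space_of_metricSpace ρ)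
    (Equiv.refl X) hc

/-- Balls of a quasisymmetric metric are comparable to balls of the original metric. -/
theorem DistortionControl.exists_radius {X : Type*} [MetricSpace X] [CompactSpace X]
    [ConnectedSpace X] [Nontrivial X] {δ : X → X → ℝ} (h : DistortionControl δ)
    (hpos : ∀ x y, x ≠ y → 0 < δ x y) (hsymm : ∀ x y, δ x y = δ y x) (M : ℝ) :
    ∃ Λ H : ℝ, 1 ≤ Λ ∧ 0 < H ∧ ∀ (x : X) (s : ℝ), 0 < s → ∃ R : ℝ, 0 < R ∧
      R ≤ 2 * Metric.diam (univ : Set X) ∧ (∀ y, δ y x < s → dist y x < R) ∧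
      (∀ y, dist y x < M * R → δ y x < Λ * s) ∧ (∀ y, dist y x < R / H → δ y x < s / 8) := by
  obtain ⟨B, hB, hup⟩ := h.upper (M * 2)
  obtain ⟨t, ht, hsm⟩ := h.small (1 / 8) (by norm_num)
  refine ⟨B, 2 / t, hB, by positivity, fun x s hs => ?_⟩
  have hb : Bornology.IsBounded (univ : Set X) := Metric.isBounded_of_compactSpace
  -- A nontrivial connected space has no isolated points.
  obtain ⟨y₁, hy₁x, hy₁⟩ : ∃ y, y ≠ x ∧ δ y x < s := by
    obtain ⟨z, hz⟩ := exists_ne x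
    obtain ⟨q, hq, hqz⟩ := h.small (s / δ x z) (div_pos hs (hpos x z hz.symm))
    have hd : 0 < dist x z := dist_pos.2 hz.symm
    have hball : Metric.ball x (q * dist x z) ∈ 𝓝[≠] x :=
      nhdsWithin_le_nhds (Metric.ball_mem_nhds x (by positivity))
    obtain ⟨y, hy, hyx⟩ := (inter_mem hball self_mem_nhdsWithin : _ ∩ {x}ᶜ ∈ 𝓝[≠] x) |>
      (NeBot.nonempty_of_mem inferInstance)
    refine ⟨y, hyx, ?_⟩
    have := hqz x y z hz.symm (Metric.mem_ball'.1 hy).le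
    rwa [div_mul_cancel₀ _ (hpos x z hz.symm).ne', hsymm] at this
  -- A point `y₀` of the `δ`-ball realises more than half of `sup S`, and `R = 2 * dist y₀ x`. Then
  -- `R` exceeds all of `S`, while distortion relative to `y₀`, where `δ y₀ x < s`, gives the other
  -- two inclusions. The doubling of `dist y₀ x` explains `M * 2` and `H = 2 / t`.
  set S : Set ℝ := (fun y => dist y x) '' {y | δ y x < s} with hS
  have hSb : BddAbove S := by
    refine ⟨Metric.diam (univ : Set X), ?_⟩
    rintro _ ⟨y, -, rfl⟩
    exact Metric.dist_le_diam_of_mem hb (mem_univ _) (mem_univ _)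
  have hL : 0 < sSup S := (dist_pos.2 hy₁x).trans_le (le_csSup hSb ⟨y₁, hy₁, rfl⟩)
  obtain ⟨_, ⟨y₀, hy₀, rfl⟩, hy₀L⟩ := exists_lt_of_lt_csSup (s := S) ⟨_, y₁, hy₁, rfl⟩
    (half_lt_self hL)
  simp only [mem_ofPred_eq] at hy₀ hy₀L
  have hd0 : 0 < dist y₀ x := by linarith
  have hne : x ≠ y₀ := (dist_pos.1 hd0).symm
  refine ⟨2 * dist y₀ x, by positivity, ?_, fun y hy => ?_, fun y hy => ?_, fun y hy => ?_⟩
  · have := Metric.dist_le_diam_of_mem hb (mem_univ y₀) (mem_univ x)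
    linarith
  · have := le_csSup hSb ⟨y, hy, rfl⟩
    simp only at this
    linarith
  · have := hup x y y₀ hne (by rw [dist_comm x y, dist_comm x y₀]; linarith)
    rw [hsymm y x]
    rw [hsymm y₀ x] at hy₀
    nlinarith
  · have := hsm x y y₀ hne (by
      rw [dist_comm x y, dist_comm x y₀]
      have e : 2 * dist y₀ x / (2 / t) = t * dist y₀ x := by field_simp
      linarith)
    rw [hsymm y x]
    rw [hsymm y₀ x] at hy₀
    linarith

end Quasisymmetry

end ConfInv
end

noncomputable section

namespace ConfInv

/-! ### Transfer of the standing assumption to a quasisymmetric metric -/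

section Transfer

/-- The `δ`-ball of radius `2r` lies in a `d`-ball of radius `R` whose shrinking to `R / H` lies in
the `δ`-ball of radius `r`; doubling for `d` compares these two. -/
theorem DistortionControl.doubling {X : Type*} [d : MetricSpace X] [MeasurableSpace X]
    [CompactSpace X] [ConnectedSpace X] [Nontrivial X] {μ : Measure X} {δ : X → X → ℝ}
    (h : DistortionControl δ) (hpos : ∀ x y, x ≠ y → 0 < δ x y)
    (hsymm : ∀ x y, δ x y = δ y x) (hμ : IsDoubling d μ) :
    ∃ A : ℝ, 1 ≤ A ∧ ∀ (x : X) (r : ℝ), 0 < r →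
      0 < μ {y | δ y x < 2 * r} ∧
      μ {y | δ y x < 2 * r} ≤ ENNReal.ofReal A * μ {y | δ y x < r} ∧
      μ {y | δ y x < r} < ∞ := by
  have := hμ.isFiniteMeasure
  obtain ⟨Λ, H, -, hH, hR⟩ := h.exists_radius hpos hsymm 1
  obtain ⟨K, hK1, hK⟩ := hμ.exists_measure_ball_le H
  refine ⟨K, by exact_mod_cast hK1, fun x r hr => ?_⟩
  obtain ⟨R, hR0, -, hR1, -, hR3⟩ := hR x (2 * r) (by positivity)
  have h1 : Metric.ball x (R / H) ⊆ {y | δ y x < r} := fun y hy => by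
    have := hR3 y hy
    simp only [mem_ofPred_eq]
    linarith
  have h2 : {y | δ y x < r} ⊆ {y | δ y x < 2 * r} := fun y hy => by
    simp only [mem_ofPred_eq] at hy ⊢
    linarith
  refine ⟨(hμ.measure_ball_pos x (div_pos hR0 hH)).trans_le (measure_mono (h1.trans h2)), ?_,
    measure_lt_top _ _⟩
  calc μ {y | δ y x < 2 * r} ≤ μ (Metric.ball x R) := measure_mono fun y hy => hR1 y hy
    _ ≤ K * μ (Metric.ball x (R / H)) :=
        hK x x _ _ (div_pos hR0 hH) (by rw [mul_div_cancel₀ _ hH.ne']) (by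
          rw [dist_self, mul_div_cancel₀ _ hH.ne']; exact hR0.le)
    _ ≤ K * μ {y | δ y x < r} := by gcongr
    _ = _ := by rw [ENNReal.ofReal_coe_nnreal]

variable {X : Type*} [d : MetricSpace X] [MeasurableSpace X] [BorelSpace X] [CompactSpace X]
  [ConnectedSpace X] [Nontrivial X] {p β : ℝ} {μ : Measure X} {D : DirichletSpace p μ}
  {δ : X → X → ℝ}

/-- The inequality is applied on a `d`-ball containing the `δ`-ball and of comparable measure.
Taking `M = σ` in `exists_radius` keeps the enlarged `d`-ball carrying the energy inside a multiple
of the `δ`-ball. -/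
theorem StandingAssumption.exists_poincare_of_distortionControl (hD : StandingAssumption D β β)
    (h : DistortionControl δ) (hpos : ∀ x y, x ≠ y → 0 < δ x y)
    (hsymm : ∀ x y, δ x y = δ y x) :
    ∃ (C : ℝ≥0) (Λ : ℝ), 1 ≤ Λ ∧ ∀ (f : C(X, ℝ)) (u : D.F),
      f =ᵐ[μ] (u : Lp ℝ (ENNReal.ofReal p) μ) → ∀ (x : X) (s : ℝ), 0 < s → ∃ c : ℝ,
      ∫⁻ y in {y | δ y x < s}, edist (f y) c ^ p ∂μ ≤
        C * μ {y | δ y x < s} * D.Γ u {y | δ y x < Λ * s} := by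
  obtain ⟨C, σ, -, hP⟩ := hD.exists_poincare
  obtain ⟨Λ, H, hΛ, hH, hR⟩ := h.exists_radius hpos hsymm σ
  obtain ⟨K, -, hK⟩ := hD.poincareDirichlet.doubling.exists_measure_ball_le H
  refine ⟨C * K, Λ, hΛ, fun f u hfu x s hs => ?_⟩
  obtain ⟨R, hR0, hRd, hR1, hR2, hR3⟩ := hR x s hs
  obtain ⟨c, hc⟩ := hP f u hfu x R hR0 hRd
  have h1 : Metric.ball x (R / H) ⊆ {y | δ y x < s} := fun y hy => by
    have := hR3 y hy
    simp only [mem_ofPred_eq]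
    linarith
  have h2 : μ (Metric.ball x R) ≤ K * μ {y | δ y x < s} :=
    (hK x x _ _ (div_pos hR0 hH) (by rw [mul_div_cancel₀ _ hH.ne']) (by
      rw [dist_self, mul_div_cancel₀ _ hH.ne']; exact hR0.le)).trans (by gcongr)
  refine ⟨c, (lintegral_mono_set fun y hy => hR1 y hy).trans (hc.trans ?_)⟩
  exact (mul_le_mul' (mul_le_mul' le_rfl h2) (measure_mono (show Metric.ball x (σ * R) ⊆ {y | δ y x < Λ * s}
    from fun y hy => hR2 y hy))).trans_eq
    (by push_cast; ring)

/-- A cutoff of the circumscribed `d`-ball works; `M = 2` matches its vanishing off the doubled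
ball. -/
theorem StandingAssumption.exists_cutoff_of_distortionControl [IsFiniteMeasure μ]
    (hD : StandingAssumption D β β) (h : DistortionControl δ)
    (hpos : ∀ x y, x ≠ y → 0 < δ x y) (hsymm : ∀ x y, δ x y = δ y x) :
    ∃ (C : ℝ≥0) (Λ : ℝ), 1 ≤ Λ ∧ ∀ (x : X) (s : ℝ), 0 < s →
      ∃ φ ∈ D.contEnergy.F, (∀ y, δ y x < s → φ y = 1) ∧ (∀ y, Λ * s ≤ δ y x → φ y = 0) ∧
        (∀ y, 0 ≤ φ y ∧ φ y ≤ 1) ∧ D.contEnergy.seminorm φ univ ≤ C := by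
  obtain ⟨C, hC⟩ := hD.exists_cutoff
  obtain ⟨Λ, H, hΛ, -, hR⟩ := h.exists_radius hpos hsymm 2
  refine ⟨C, Λ, hΛ, fun x s hs => ?_⟩
  obtain ⟨R, hR0, hRd, hR1, hR2, -⟩ := hR x s hs
  obtain ⟨φ, hφF, h1, h0, hI, hE⟩ := hC x R hR0 hRd
  exact ⟨φ, hφF, fun y hy => h1 y (hR1 y hy), fun y hy => h0 y fun hy' =>
    not_lt.2 hy (hR2 y hy'), hI, hE⟩

end Transfer

/-! ### Comparison of the two Sobolev structures -/

section Comparison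

variable {X : Type*} [d : MetricSpace X] [MeasurableSpace X]

/-- The energy `Ξ` of an everywhere defined function. -/
def AuxSobolev.funΞ (S : AuxSobolev X) (Q : ℝ) (f : X → ℝ) : ℝ≥0∞ :=
  ⨆ (r : ℝ) (_ : 0 < r),
    ∫⁻ x, (⨍⁻ y in S.ball x r, edist (f x) (f y) ^ Q / S.ν (S.ball x r) ∂S.ν) ∂S.ν

theorem AuxSobolev.Ξ_eq_funΞ (S : AuxSobolev X) {Q : ℝ} (hQ : 0 ≤ Q) {f : X → ℝ}
    {v : Lp ℝ (ENNReal.ofReal Q) S.ν} (h : f =ᵐ[S.ν] v) : S.Ξ Q v = S.funΞ Q f := by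
  simp only [AuxSobolev.Ξ, AuxSobolev.funΞ, ofReal_abs_sub_rpow hQ]
  refine iSup_congr fun r => iSup_congr fun _ => lintegral_congr_ae ?_
  filter_upwards [h] with x hx
  refine laverage_congr (ae_restrict_of_ae ?_)
  filter_upwards [h] with y hy
  rw [hx, hy]

/-- The metric `ρ` with its topology replaced by the (equal) topology of `d`. -/
abbrev AuxSobolev.metric [CompactSpace X] (S : AuxSobolev X) : MetricSpace X :=
  S.ρ.replaceTopology S.quasisymmetric.topology_eq

theorem AuxSobolev.isFiniteMeasure [CompactSpace X] (S : AuxSobolev X) : IsFiniteMeasure S.ν := by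
  exact @IsDoubling.isFiniteMeasure X S.metric _ S.ν ‹CompactSpace X› S.doubling

variable [BorelSpace X] {Q β : ℝ} {μ : Measure X} {D : DirichletSpace Q μ}

theorem StandingAssumption.isFiniteMeasure {dH : ℝ} (hD : StandingAssumption D β dH) :
    IsFiniteMeasure μ :=
  have := hD.compact
  hD.poincareDirichlet.doubling.isFiniteMeasure

/-- Comparison of the energies on continuous functions. -/
theorem StandingAssumption.exists_energy_comparison [Nonempty X] [CompactSpace X]
    [IsFiniteMeasure μ] (hD : StandingAssumption D β β) (S : AuxSobolev X) :
    ∃ K : ℝ≥0, (∀ f ∈ D.contEnergy.F, S.funΞ Q f ≤ K * D.contEnergy.Γ f univ ∧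
      ∫⁻ x, edist (f x) (⨍ z, f z ∂μ) ^ Q ∂μ ≤ K * D.contEnergy.Γ f univ ∧
      ∫⁻ x, edist (f x) (⨍ z, f z ∂μ) ^ Q ∂S.ν ≤ K * D.contEnergy.Γ f univ) ∧
      ∀ f : C(X, ℝ), S.funΞ Q f < ∞ →
        f ∈ D.contEnergy.F ∧ D.contEnergy.Γ f univ ≤ K * S.funΞ Q f := by
  have hQ : 1 ≤ Q := D.one_lt.le
  have := hD.connectedSpace
  have := hD.nontrivial
  let δ : X → X → ℝ := fun x y => S.ρ.toPseudoMetricSpace.toDist.dist x y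
  have hδ : DistortionControl δ := S.quasisymmetric.distortionControl
  have hpos : ∀ x y, x ≠ y → 0 < δ x y := fun x y hxy => (@dist_pos X S.ρ x y).2 hxy
  have hsymm : ∀ x y, δ x y = δ y x := S.ρ.toPseudoMetricSpace.dist_comm
  -- `S.metric` has the distance of `ρ` but literally the topology of `d`, so continuous functions
  -- and Borel sets are shared by both metrics.
  have hν : @IsDoubling X S.metric _ S.ν := S.doubling
  have hμ : @IsDoubling X S.metric _ μ := hδ.doubling hpos hsymm hD.poincareDirichlet.doubling
  obtain ⟨C₁, Λ₁, hΛ₁, hP⟩ := hD.exists_poincare_of_distortionControl hδ hpos hsymm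
  obtain ⟨C₂, Λ₂, hΛ₂, hC⟩ := hD.exists_cutoff_of_distortionControl hδ hpos hsymm
  have hP' : ∀ f ∈ D.contEnergy.F,
      @Poincare X S.metric _ μ (D.contEnergy.Γ f) Q C₁ Λ₁ f := by
    rintro f ⟨u, hu⟩
    rw [show D.contEnergy.Γ f = D.Γ u from DirichletSpace.contΓ_eq hu]
    exact hP f u hu
  have hC' : @ContEnergy.HasCutoffs X S.metric _ Q D.contEnergy C₂ Λ₂ := hC
  obtain ⟨K₁, hK₁⟩ := @IsDoubling.exists_ksEnergy_le X S.metric _ ‹BorelSpace X› ‹CompactSpace X› μ S.ν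
    ‹ConnectedSpace X› _ hμ hν Q hQ C₁ Λ₁ hΛ₁
  obtain ⟨K₂, hK₂⟩ := @IsDoubling.exists_lintegral_edist_average_le X S.metric _ ‹BorelSpace X›
    ‹CompactSpace X› μ S.ν ‹ConnectedSpace X› _ hμ hν Q hQ C₁ Λ₁ hΛ₁
  -- The same oscillation bound with `μ` itself as the second measure.
  obtain ⟨K₃, hK₃⟩ := @IsDoubling.exists_lintegral_edist_average_le X S.metric _ ‹BorelSpace X›
    ‹CompactSpace X› μ μ ‹ConnectedSpace X› _ hμ hμ Q hQ C₁ Λ₁ hΛ₁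
  obtain ⟨K₄, hK₄⟩ := @ContEnergy.HasCutoffs.exists_energy_le X S.metric _ Q ‹BorelSpace X› S.ν
    ‹CompactSpace X› _ D.contEnergy C₂ Λ₂ hC' hQ hΛ₂ hν
  refine ⟨K₁ + K₂ + K₃ + K₄, fun f hf => ?_, fun f hf => ?_⟩
  · have := D.contEnergy.finite f hf
    refine ⟨(hK₁ f _ (hP' f hf)).trans ?_, (hK₃ f _ (hP' f hf)).trans ?_,
      (hK₂ f _ (hP' f hf)).trans ?_⟩
    · gcongr
      exact le_add_right (le_add_right (le_add_right le_rfl))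
    · gcongr
      exact le_add_right (le_add_left le_rfl)
    · gcongr
      exact le_add_right (le_add_right (le_add_left le_rfl))
  · obtain ⟨h1, h2⟩ := hK₄ f hf
    refine ⟨h1, h2.trans (mul_le_mul' ?_ le_rfl)⟩
    exact_mod_cast (le_add_left le_rfl : K₄ ≤ K₁ + K₂ + K₃ + K₄)

/-- Two Lebesgue norms of a function with controlled oscillation are comparable. -/
theorem exists_eLpNorm_le {Y : Type*} [MeasurableSpace Y] {μ ν : Measure Y} [IsFiniteMeasure μ]
    [IsFiniteMeasure ν] (hμ : μ univ ≠ 0) (hQ : 1 ≤ Q) :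
    ∃ L : ℝ≥0, ∀ (f : Y → ℝ) (m : ℝ) (T : ℝ≥0∞), Measurable f →
      ∫⁻ x, edist (f x) m ^ Q ∂μ ≤ T → ∫⁻ x, edist (f x) m ^ Q ∂ν ≤ T →
      eLpNorm f (ENNReal.ofReal Q) ν ≤ L * (eLpNorm f (ENNReal.ofReal Q) μ + T ^ (1 / Q)) := by
  have hQ0 : 0 < Q := by linarith
  have h1 : (1 : ℝ≥0∞) ≤ ENNReal.ofReal Q := by simpa using hQ
  have hne : ENNReal.ofReal Q ≠ 0 := by simpa using hQ0
  have htr : (ENNReal.ofReal Q).toReal = Q := ENNReal.toReal_ofReal hQ0.le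
  set a : ℝ≥0∞ := μ univ ^ (1 / Q) with ha
  set b : ℝ≥0∞ := ν univ ^ (1 / Q) with hb
  have ha0 : a ≠ 0 := by
    simp [ha, ENNReal.rpow_eq_zero_iff, hμ, measure_ne_top]
  have hat : a ≠ ∞ := ENNReal.rpow_ne_top_of_nonneg (by positivity) (measure_ne_top _ _)
  have hbt : b ≠ ∞ := ENNReal.rpow_ne_top_of_nonneg (by positivity) (measure_ne_top _ _)
  refine ⟨(b / a).toNNReal + 1, fun f m T hf hTμ hTν => ?_⟩
  have hosc : ∀ κ : Measure Y, ∫⁻ x, edist (f x) m ^ Q ∂κ ≤ T →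
      eLpNorm (fun x => f x - m) (ENNReal.ofReal Q) κ ≤ T ^ (1 / Q) := by
    intro κ hκ
    rw [eLpNorm_eq_lintegral_rpow_enorm_toReal hne ENNReal.ofReal_ne_top, htr]
    refine ENNReal.rpow_le_rpow (le_trans (le_of_eq ?_) hκ) (by positivity)
    simp_rw [edist_eq_enorm_sub]
  have hconst : ∀ κ : Measure Y, eLpNorm (fun _ : Y => m) (ENNReal.ofReal Q) κ =
      ‖m‖ₑ * κ univ ^ (1 / Q) := fun κ => by
    rw [eLpNorm_const' m hne ENNReal.ofReal_ne_top, htr]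
  -- The size of the constant `m` is recovered from the `μ`-norm, since `μ` has positive mass, and
  -- then carried over to `ν`.
  have hm : ‖m‖ₑ * a ≤ eLpNorm f (ENNReal.ofReal Q) μ + T ^ (1 / Q) := by
    rw [ha, ← hconst μ]
    calc _ = eLpNorm (f - fun x => f x - m) (ENNReal.ofReal Q) μ := by
          congr 1; ext x; simp
      _ ≤ _ := (eLpNorm_sub_le hf.aestronglyMeasurable
          (hf.sub_const m).aestronglyMeasurable h1).trans (add_le_add le_rfl (hosc μ hTμ))
  calc eLpNorm f (ENNReal.ofReal Q) ν
      = eLpNorm ((fun _ => m) + fun x => f x - m) (ENNReal.ofReal Q) ν := by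
        congr 1; ext x; simp
    _ ≤ ‖m‖ₑ * b + T ^ (1 / Q) := by
        rw [hb, ← hconst ν]
        exact (eLpNorm_add_le measurable_const.aestronglyMeasurable
          (hf.sub_const m).aestronglyMeasurable h1).trans (add_le_add le_rfl (hosc ν hTν))
    _ = b / a * (‖m‖ₑ * a) + T ^ (1 / Q) := by
        rw [mul_comm ‖m‖ₑ a, ← mul_assoc, ENNReal.div_mul_cancel ha0 hat, mul_comm b]
    _ ≤ b / a * (eLpNorm f (ENNReal.ofReal Q) μ + T ^ (1 / Q)) +
          1 * (eLpNorm f (ENNReal.ofReal Q) μ + T ^ (1 / Q)) := by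
        rw [one_mul]
        gcongr
        exact le_add_left le_rfl
    _ = _ := by
        rw [← add_mul, ENNReal.coe_add, ENNReal.coe_toNNReal (ENNReal.div_ne_top hbt ha0),
          ENNReal.coe_one]

/-- The upper bound is subadditivity of `t ↦ t ^ (1 / Q)`, valid as `Q ≥ 1`. -/
theorem sobolevNorm_bounds {X : Type*} [MeasurableSpace X] {μ : Measure X} (hQ : 1 ≤ Q) {F : Submodule ℝ (Lp ℝ (ENNReal.ofReal Q) μ)}
    (E : F → ℝ≥0) (u : F) :
    ‖(u : Lp ℝ (ENNReal.ofReal Q) μ)‖ ≤ sobolevNorm E u ∧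
      (E u : ℝ) ^ (1 / Q) ≤ sobolevNorm E u ∧
      sobolevNorm E u ≤ ‖(u : Lp ℝ (ENNReal.ofReal Q) μ)‖ + (E u : ℝ) ^ (1 / Q) := by
  have hQ0 : 0 < Q := by linarith
  have hn : 0 ≤ ‖(u : Lp ℝ (ENNReal.ofReal Q) μ)‖ := ENNReal.toReal_nonneg
  set n := ‖(u : Lp ℝ (ENNReal.ofReal Q) μ)‖ with hn'
  have hroot : (n ^ Q) ^ (1 / Q) = n := by
    rw [← Real.rpow_mul hn, mul_one_div_cancel hQ0.ne', Real.rpow_one]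
  have hE : (0 : ℝ) ≤ E u := (E u).coe_nonneg
  have hnQ : 0 ≤ n ^ Q := Real.rpow_nonneg hn Q
  refine ⟨?_, ?_, ?_⟩
  · conv_lhs => rw [← hroot]
    exact Real.rpow_le_rpow hnQ (by linarith) (by positivity)
  · exact Real.rpow_le_rpow hE (by linarith) (by positivity)
  · conv_rhs => rw [← hroot]
    exact Real.rpow_add_le_add_rpow hnQ hE (by positivity)
      (by rw [div_le_one hQ0]; exact hQ)

end Comparison

end ConfInv
end

/-! ### The theorem: equality of the spaces and comparison of the norms -/

theorem proposition4p5 {X : Type*} [MetricSpace X] [MeasurableSpace X] [BorelSpace X]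
    (Q β dH : ℝ) (μ : Measure X) (D : ConfInv.DirichletSpace Q μ)
    (hD : ConfInv.StandingAssumption D β dH) (hβ : dH = β)
    (S : ConfInv.AuxSobolev X) :
    ConfInv.contIn (D.F : Set (Lp ℝ (ENNReal.ofReal Q) μ)) = ConfInv.contIn (S.W Q) ∧
    ∃ C : ℝ, 1 ≤ C ∧ ∀ f ∈ ConfInv.contIn (D.F : Set (Lp ℝ (ENNReal.ofReal Q) μ)),
      ∀ (u : D.F) (v : Lp ℝ (ENNReal.ofReal Q) S.ν),
        f =ᵐ[μ] (u : Lp ℝ (ENNReal.ofReal Q) μ) → f =ᵐ[S.ν] v →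
          C⁻¹ * S.normW Q v ≤ ConfInv.sobolevNorm D.E u ∧
          ConfInv.sobolevNorm D.E u ≤ C * S.normW Q v := by
  subst hβ
  have hQ : 1 ≤ Q := D.one_lt.le
  have hQ0 : 0 < Q := by linarith
  have := hD.compact
  have := hD.isFiniteMeasure
  have := S.isFiniteMeasure
  -- On the empty space all norms and energies vanish; the comparison needs a point.
  rcases isEmpty_or_nonempty X with hX | hX
  · have hμ0 : μ = 0 := Measure.eq_zero_of_isEmpty μ
    have hν0 : S.ν = 0 := Measure.eq_zero_of_isEmpty S.ν
    have hΞ : ∀ v, S.Ξ Q v = 0 := fun v => by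
      simp [ConfInv.AuxSobolev.Ξ]
    refine ⟨?_, 1, le_rfl, fun f _ u v _ _ => ?_⟩
    · refine Set.ext fun f => ⟨fun _ => ⟨0, ?_, ?_⟩, fun _ => ⟨0, D.F.zero_mem, ?_⟩⟩
      · simp [ConfInv.AuxSobolev.W, hΞ]
      · exact Filter.Eventually.of_forall fun x => (hX.false x).elim
      · exact Filter.Eventually.of_forall fun x => (hX.false x).elim
    · have hv : ‖v‖ = 0 := by
        have h0 : ∀ g : X → ℝ, eLpNorm g (ENNReal.ofReal Q) S.ν = 0 := fun g => by
          rw [hν0, eLpNorm_measure_zero]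
        rw [Lp.norm_def, h0, ENNReal.toReal_zero]
      have hu : ‖(u : Lp ℝ (ENNReal.ofReal Q) μ)‖ = 0 := by
        have h0 : ∀ g : X → ℝ, eLpNorm g (ENNReal.ofReal Q) μ = 0 := fun g => by
          rw [hμ0, eLpNorm_measure_zero]
        rw [Lp.norm_def, h0, ENNReal.toReal_zero]
      have hE : D.E u = 0 := by
        have := D.mass u
        rw [Measure.eq_zero_of_isEmpty (D.Γ u)] at this
        simpa using this.symm
      simp [ConfInv.AuxSobolev.normW, ConfInv.sobolevNorm, hv, hu, hE, hΞ, hQ0.ne']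
  obtain ⟨K, hK1, hK2⟩ := hD.exists_energy_comparison S
  have hμ0 : μ univ ≠ 0 :=
    ((hD.poincareDirichlet.doubling.measure_ball_pos (Classical.arbitrary X) one_pos).trans_le
      (measure_mono (subset_univ _))).ne'
  have hν0 : S.ν univ ≠ 0 := by
    obtain ⟨A, -, hA⟩ := S.doubling
    exact ((hA (Classical.arbitrary X) 1 one_pos).1.trans_le (measure_mono (subset_univ _))).ne'
  refine ⟨?_, ?_⟩
  · ext f
    constructor
    · rintro ⟨u, hu, hfu⟩
      have hf : f ∈ D.contEnergy.F := ⟨⟨u, hu⟩, hfu⟩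
      have hfin := D.contEnergy.finite f hf
      have hfv := (ConfInv.memLp_continuousMap S.ν (ENNReal.ofReal Q) f).coeFn_toLp.symm
      refine ⟨_, ?_, hfv⟩
      change S.Ξ Q _ < ∞
      rw [S.Ξ_eq_funΞ hQ0.le hfv]
      exact (hK1 f hf).1.trans_lt (ENNReal.mul_lt_top (by simp) (measure_lt_top _ _))
    · rintro ⟨v, hv, hfv⟩
      change S.Ξ Q v < ∞ at hv
      rw [S.Ξ_eq_funΞ hQ0.le hfv] at hv
      obtain ⟨u, hu⟩ := (hK2 f hv).1
      exact ⟨u, u.2, hu⟩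
  · obtain ⟨L₁, hL₁⟩ := ConfInv.exists_eLpNorm_le (ν := S.ν) hμ0 hQ
    obtain ⟨L₂, hL₂⟩ := ConfInv.exists_eLpNorm_le (ν := μ) hν0 hQ
    set κ : ℝ := (K : ℝ) ^ (1 / Q) with hκ
    have hκ0 : 0 ≤ κ := by positivity
    -- The first bracket bounds the norm of `W` by the Sobolev norm, the second does the converse,
    -- and the summand `1` ensures `1 ≤ C`.
    refine ⟨1 + (L₁ + L₁ * κ + κ) + (L₂ + (L₂ * κ + 1) * κ), ?_, fun f hf u v hfu hfv => ?_⟩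
    · have : (0 : ℝ) ≤ (L₁ + L₁ * κ + κ) + (L₂ + (L₂ * κ + 1) * κ) := by positivity
      linarith
    have hfF : f ∈ D.contEnergy.F := ⟨u, hfu⟩
    obtain ⟨k1, k2, k3⟩ := hK1 f hfF
    have hΓ : D.contEnergy.Γ f univ = D.E u := by
      rw [← D.mass u]
      exact congrArg (fun m : Measure X => m univ) (ConfInv.DirichletSpace.contΓ_eq hfu)
    rw [hΓ] at k1 k2 k3
    have hΞfin : S.funΞ Q f < ∞ := k1.trans_lt (ENNReal.mul_lt_top (by simp) (by simp))
    have k4 := (hK2 f hΞfin).2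
    rw [hΓ] at k4
    have l1 := hL₁ f _ _ f.continuous.measurable k2 k3
    have l2 := hL₂ f _ _ f.continuous.measurable k3 k2
    have eu : ‖(u : Lp ℝ (ENNReal.ofReal Q) μ)‖ = (eLpNorm f (ENNReal.ofReal Q) μ).toReal := by
      rw [Lp.norm_def, eLpNorm_congr_ae hfu]
    have ev : ‖v‖ = (eLpNorm f (ENNReal.ofReal Q) S.ν).toReal := by
      rw [Lp.norm_def, eLpNorm_congr_ae hfv]
    have fu := (ConfInv.memLp_continuousMap μ (ENNReal.ofReal Q) f).eLpNorm_ne_top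
    have fv := (ConfInv.memLp_continuousMap S.ν (ENNReal.ofReal Q) f).eLpNorm_ne_top
    obtain ⟨s1, s2, s3⟩ := ConfInv.sobolevNorm_bounds hQ D.E u
    rw [eu] at s1 s3
    simp only [ConfInv.AuxSobolev.normW]
    rw [ev, S.Ξ_eq_funΞ hQ0.le hfv]
    set e : ℝ := (D.E u : ℝ) ^ (1 / Q) with he
    have he0 : 0 ≤ e := Real.rpow_nonneg (D.E u).coe_nonneg _
    have hT : ((K * D.E u : ℝ≥0∞) ^ (1 / Q)).toReal = κ * e := by
      rw [← ENNReal.toReal_rpow, ENNReal.toReal_mul, ENNReal.coe_toReal, ENNReal.coe_toReal,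
        Real.mul_rpow K.coe_nonneg (D.E u).coe_nonneg]
    have hTt : (K * D.E u : ℝ≥0∞) ^ (1 / Q) ≠ ∞ :=
      ENNReal.rpow_ne_top_of_nonneg (by positivity) (ENNReal.mul_ne_top (by simp) (by simp))
    lift eLpNorm f (ENNReal.ofReal Q) μ to ℝ≥0 using fu with a
    lift eLpNorm f (ENNReal.ofReal Q) S.ν to ℝ≥0 using fv with b
    lift (K * D.E u : ℝ≥0∞) ^ (1 / Q) to ℝ≥0 using hTt with T
    lift S.funΞ Q f to ℝ≥0 using hΞfin.ne with ξ
    simp only [ENNReal.coe_toReal] at *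
    set x : ℝ := (ξ : ℝ) ^ (1 / Q) with hx
    have hx0 : 0 ≤ x := Real.rpow_nonneg ξ.coe_nonneg _
    have m1 : (b : ℝ) ≤ L₁ * (a + κ * e) := by rw [← hT]; exact_mod_cast l1
    have m2 : (a : ℝ) ≤ L₂ * (b + κ * e) := by rw [← hT]; exact_mod_cast l2
    have m3 : x ≤ κ * e := by
      have : (ξ : ℝ) ≤ K * D.E u := by exact_mod_cast k1
      rw [hx, hκ, he, ← Real.mul_rpow K.coe_nonneg (D.E u).coe_nonneg]
      exact Real.rpow_le_rpow ξ.coe_nonneg this (by positivity)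
    have m4 : e ≤ κ * x := by
      have : (D.E u : ℝ) ≤ K * ξ := by exact_mod_cast k4
      rw [hx, hκ, he, ← Real.mul_rpow K.coe_nonneg ξ.coe_nonneg]
      exact Real.rpow_le_rpow (D.E u).coe_nonneg this (by positivity)
    have ha0 : (0 : ℝ) ≤ a := a.coe_nonneg
    have hb0 : (0 : ℝ) ≤ b := b.coe_nonneg
    have hL₁0 : (0 : ℝ) ≤ L₁ := L₁.coe_nonneg
    have hL₂0 : (0 : ℝ) ≤ L₂ := L₂.coe_nonneg
    set s := ConfInv.sobolevNorm D.E u with hs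
    have hs0 : 0 ≤ s := ha0.trans s1
    have c1 : 0 ≤ L₁ + L₁ * κ + κ := by positivity
    have c2 : 0 ≤ L₂ + (L₂ * κ + 1) * κ := by positivity
    constructor
    · rw [inv_mul_le_iff₀ (by positivity)]
      calc (b : ℝ) + x ≤ L₁ * (s + κ * s) + κ * s := by
            refine add_le_add (m1.trans ?_) (m3.trans ?_) <;> gcongr
        _ = (L₁ + L₁ * κ + κ) * s := by ring
        _ ≤ _ := mul_le_mul_of_nonneg_right (by linarith) hs0
    · calc s ≤ L₂ * (b + κ * (κ * x)) + κ * x := by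
            refine s3.trans (add_le_add (m2.trans ?_) m4)
            gcongr
        _ ≤ (L₂ + (L₂ * κ + 1) * κ) * (b + x) := by
            have h1 : 0 ≤ ((L₂ : ℝ) * κ + 1) * κ * b := by positivity
            have h2 : 0 ≤ (L₂ : ℝ) * x := by positivity
            nlinarith
        _ ≤ _ := mul_le_mul_of_nonneg_right (by linarith) (by positivity)
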